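/- Let $\mathbb K$ be $\mathbb R$ or $\mathbb C$ and let $\mathfrak g$ be one of the matrix Lie algebras $gl(n)$ ($n\ge 1$), $so(2n+1)=\{X: X=-sX^{\top}s\}$ with $s=\mathrm{diag}(1,s_{2n})$ ($n\ge 2$), $sp(n)=\{X\in gl(2n): X=wX^{\top}w\}$ ($n\ge 1$), $so(2n)=\{X: X=-s_{2n}X^{\top}s_{2n}\}$ ($n\ge 2$) over $\mathbb K$, where $s_{2n}=\begin{pmatrix}0&1_n\\1_n&0\end{pmatrix}$ and $w=\begin{pmatrix}0&1_n\\-1_n&0\end{pmatrix}$. Let $h=n,\,2n,\,2n,\,2n-2$ respectively, and let $\mathfrak g=\bigoplus_{j\in\mathbb Z/h\mathbb Z}\mathfrak g_{\bar j}$ be the principal grading ($\mathfrak g_{\bar 0}$ is the diagonal Cartan subalgebra, and for $\bar j\neq 0$ the space $\mathfrak g_{\bar j}$ is spanned by the root vectors of the roots of height $\equiv j \bmod h$). Let $a_1,a_2,\dots\in\mathbb K$, let $X_{pq}$ be the matrix units, and let $A$ be $\sum_{i=1}^{n-1}a_iX_{i,i+1}+a_nX_{n,1}$ for $gl(n)$;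 $\sum_{i=1}^{n-1}a_i(X_{i+1,i+2}+X_{n+i+2,n+i+1})+a_n(X_{n+1,1}+X_{1,2n+1})+a_{n+1}(X_{n+2,3}+X_{n+3,2})$ for $so(2n+1)$; $\sum_{i=1}^{n-1}a_i(X_{i,i+1}+X_{n+i+1,n+i})$ for $sp(n)$; $\sum_{i=1}^{n-1}a_i(X_{i,i+1}+X_{n+i+1,n+i})+a_n(X_{n,2n-1}+X_{n-1,2n})+a_{n+1}(X_{n+1,2}+X_{n+2,1})$ for $so(2n)$. Put $A(\lambda)=1-\lambda A$. Let $\tilde{\mathfrak g}^{\rm pr}_A=\bigoplus_{j\in\mathbb Z}\mathfrak g_{\bar j}\lambda^j$ (finite sums) with the bracket $[X,Y]_{A(\lambda)}=XA(\lambda)Y-YA(\lambda)X$, and let $\tilde{\mathfrak g}^{\rm pr+}_A$, $\tilde{\mathfrak g}^{\rm pr-}_A$ be its subspaces of sums over $j\ge 0$ and over $j<0$. Let the dual space $(\tilde{\mathfrak g}^{\rm pr}_A)^*$ consist of all (possibly infinite in both directions) formal series $L(\lambda)=\sum_{i\in\mathbb Z}L_i\lambda^i$ with $L_i\in\mathfrak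 g_{\bar i}$, paired with $\tilde{\mathfrak g}^{\rm pr}_A$ by $\langle X,L\rangle=\mathrm{res}_{\lambda=0}\lambda^{-1}\mathrm{Tr}(X(\lambda)L(\lambda))$. Put $L^+=\sum_{i>0}L_i\lambda^i$ and $L^-=\sum_{i\le 0}L_i\lambda^i$. Polynomial functions on the dual space are the polynomials in finitely many of the coordinate functions $\langle X,\cdot\rangle$; the gradient $\nabla F(L)\in\tilde{\mathfrak g}^{\rm pr}_A$ is defined by $\frac{d}{dr}F(L+rZ)|_{r=0}=\langle\nabla F(L),Z\rangle$ for all $Z$ in the dual space, and the Lie-Poisson bracket is $\{F,G\}(L)=\langle[\nabla F(L),\nabla G(L)]_{A(\lambda)},L\rangle$. For integers $m\ge1$ and $k$ let $$I^{m\pm}_k(L)=I^m_k(L^{\pm})=\tfrac1m\,\mathrm{res}_{\lambda=0}\,\lambda^{-k-1}\,\mathrm{Tr}\bigl(L^{\pm}(\lambda)A(\lambda)^{-1}\bigr)^m ,$$ where $A(\lambda)^{-1}$ is expanded in formal Laurent series in $\lambda$ (at $\lambda=0$) for $L^+$ and in formal Laurent series in $\lambda^{-1}$ (at $\lambda=\infty$)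 for $L^-$, and $\mathrm{res}_{\lambda=0}$ is the coefficient of $\lambda^{-1}$. Theorem. Each $I^{m\mp}_k$ is a polynomial function on $(\tilde{\mathfrak g}^{\rm pr}_A)^*$, and at every $L$ its gradient $M^{m\pm}_k=\nabla I^m_k(L^{\mp})$ exists, is unique, and lies in $\tilde{\mathfrak g}^{\rm pr\pm}_A$. Moreover: (i) The Hamiltonian flows $\partial L/\partial t^{m\mp}_k=\{L,I^{m\mp}_k\}$ are well defined and commute, for all the times $t^{m+}_k$, $t^{n-}_l$ (any two, of equal or different sign): each $F\mapsto\{F,I^{m\mp}_k\}$ maps the algebra of polynomial functions to itself, any two of these maps commute, and through every point $L_0$ of the dual space there is exactly one joint formal trajectory in all the times (an algebra homomorphism $\Phi$ from the polynomial functions to the formal power series in all the times, with constant terms $F(L_0)$ and with $\partial\Phi(F)/\partial t^{m\mp}_k=\Phi(\{F,I^{m\mp}_k\})$). (ii) The Hamiltonian vector field of $I^{m\mp}_k$ (the unique $V(L)$ in the dual space with $\langle X,V(L)\rangle=\{\langle X,\cdot\rangle,I^{m\mp}_k\}(L)$ for all $X\in\tilde{\mathfrak g}^{\rm pr}_A$)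 exists and equals $A(\lambda)M^{m\pm}_kL-LM^{m\pm}_kA(\lambda)$; so a curve $t\mapsto L(t)$ in the dual space solves the Hamiltonian equations if and only if, coefficientwise, it solves the deformed Lax equation $$\frac{\partial L(\lambda)}{\partial t^{m\mp}_k}=A(\lambda)M^{m\pm}_k(\lambda)L(\lambda)-L(\lambda)M^{m\pm}_k(\lambda)A(\lambda).$$ (iii) All the functions $I^p_q(L^{\pm})$ are conserved along all the flows: all the Poisson brackets $\{I^p_q(L^{\pm}),I^{m\pm}_k\}$, with all combinations of signs, vanish, and $I^p_q(L^{\pm}(t))$ is constant along every solution curve $L(t)$ of each of the flows, on every connected open set of times (real times, and complex times if $\mathbb K=\mathbb C$). -/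

import Mathlib

open scoped LaurentPolynomial

noncomputable section

namespace QuasigradedLie

/-! ### The classical matrix Lie algebras and their principal grading -/

/-- The four series `gl(n)`, `so(2n+1)`, `sp(n)`, `so(2n)` of classical matrix Lie algebras. -/
inductive Series
  | gl
  | soOdd
  | sp
  | soEven

/-- The smallest `n` which is allowed in each series. -/
def Series.minRank : Series → ℕ
  | .gl => 1
  | .soOdd => 2
  | .sp => 1
  | .soEven => 2

/-- The size of the matrices. -/
def Series.size : Series → ℕ → ℕ
  | .gl, n => n
  | .soOdd, n => 2 * n + 1
  | .sp, n => 2 * n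
  | .soEven, n => 2 * n

/-- The Coxeter number `h`. -/
def Series.coxeter : Series → ℕ → ℕ
  | .gl, n => n
  | .soOdd, n => 2 * n
  | .sp, n => 2 * n
  | .soEven, n => 2 * n - 2

/-- Square matrices of the size that belongs to the series. -/
abbrev Mat (c : Series) (n : ℕ) (𝕜 : Type*) := Matrix (Fin (c.size n)) (Fin (c.size n)) 𝕜

section Classical

variable {𝕜 : Type*} [RCLike 𝕜]

/-- The matrix unit `X_{pq}`, with rows and columns numbered from `1`. -/
def unitX (N p q : ℕ) : Matrix (Fin N) (Fin N) 𝕜 :=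
  Matrix.of fun i j => if (i : ℕ) + 1 = p ∧ (j : ℕ) + 1 = q then 1 else 0

/-- `s = [[0, 1], [1, 0]]` in blocks of size `n`. -/
def formEven (n : ℕ) : Mat .soEven n 𝕜 :=
  Matrix.of fun i j => if (j : ℕ) = i + n ∨ (i : ℕ) = j + n then 1 else 0

/-- `s = diag(1, s_{2n})`, where `s_{2n} = [[0, 1], [1, 0]]` in blocks of size `n`. -/
def formOdd (n : ℕ) : Mat .soOdd n 𝕜 :=
  Matrix.of fun i j =>
    if ((i : ℕ) = 0 ∧ (j : ℕ) = 0) ∨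
      (0 < (i : ℕ) ∧ 0 < (j : ℕ) ∧ ((j : ℕ) = i + n ∨ (i : ℕ) = j + n)) then 1 else 0

/-- `w = [[0, 1], [-1, 0]]` in blocks of size `n`. -/
def formSp (n : ℕ) : Mat .sp n 𝕜 :=
  Matrix.of fun i j => if (j : ℕ) = i + n then 1 else if (i : ℕ) = j + n then -1 else 0

/-- The condition that cuts the classical Lie algebra out of all matrices. -/
def IsClassical : (c : Series) → (n : ℕ) → Mat c n 𝕜 → Prop
  | .gl, _, _ => True
  | .soOdd, n, X => X = -(formOdd n * Matrix.transpose X * formOdd n)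
  | .sp, n, X => X = formSp n * Matrix.transpose X * formSp n
  | .soEven, n, X => X = -(formEven n * Matrix.transpose X * formEven n)

/-- The classical Lie algebra `𝔤`, as a space of matrices. -/
def classical (c : Series) (n : ℕ) : Submodule 𝕜 (Mat c n 𝕜) where
  carrier := {X | IsClassical c n X}
  zero_mem' := by cases c <;> simp [IsClassical]
  add_mem' := by
    intro X Y hX hY
    cases c
    · trivial
    all_goals
      simp only [Set.mem_ofPred_eq, IsClassical] at hX hY ⊢
      rw [Matrix.transpose_add, Matrix.mul_add, Matrix.add_mul]
      try rw [neg_add]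
      rw [← hX, ← hY]
  smul_mem' := by
    intro r X hX
    cases c
    · trivial
    all_goals
      simp only [Set.mem_ofPred_eq, IsClassical] at hX ⊢
      rw [Matrix.transpose_smul, Matrix.mul_smul, Matrix.smul_mul]
      try rw [← smul_neg]
      rw [← hX]

/-- The weights of the basis vectors (numbered from `1`) such that the root vector with a nonzero
entry at `(p, q)` has a root of height `wt p - wt q`: this difference is `1` on all simple root
vectors. -/
def wt : Series → ℕ → ℕ → ℤ
  | .gl, _, p => -p
  | .soOdd, n, p => if p = 1 then 0 else if p ≤ n + 1 then n + 2 - p else p - 2 * n - 2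
  | .sp, n, p => if p ≤ n then n + 1 - p else p - 2 * n
  | .soEven, n, p => if p ≤ n then n - p else p - 2 * n

/-- The subspace `𝔤_j`, `j ∈ ℤ / h ℤ`, of the principal grading: the span of the root vectors
with roots of height congruent to `j` modulo `h` (for `j = 0`: the Cartan subalgebra). -/
def grade (c : Series) (n : ℕ) (j : ZMod (c.coxeter n)) : Submodule 𝕜 (Mat c n 𝕜) where
  carrier := {X | X ∈ classical c n ∧ ∀ a b : Fin (c.size n),
    ((wt c n (a + 1) - wt c n (b + 1) : ℤ) : ZMod (c.coxeter n)) ≠ j → X a b = 0}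
  zero_mem' := ⟨Submodule.zero_mem _, fun _ _ _ => rfl⟩
  add_mem' := fun {X Y} hX hY => ⟨Submodule.add_mem _ hX.1 hY.1, fun a b h => by
    rw [Matrix.add_apply, hX.2 a b h, hY.2 a b h, add_zero]⟩
  smul_mem' := fun r X hX => ⟨Submodule.smul_mem _ r hX.1, fun a b h => by
    rw [Matrix.smul_apply, hX.2 a b h, smul_zero]⟩

/-- The deformation matrix `A` with parameters `a 1, a 2, …`. -/
def deformationMatrix : (c : Series) → (n : ℕ) → (a : ℕ → 𝕜) → Mat c n 𝕜
  | .gl, n, a => ∑ i ∈ Finset.Icc 1 (n - 1), a i • unitX _ i (i + 1) + a n • unitX _ n 1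
  | .soOdd, n, a =>
      ∑ i ∈ Finset.Icc 1 (n - 1),
          a i • (unitX _ (i + 1) (i + 2) + unitX _ (n + i + 2) (n + i + 1))
        + a n • (unitX _ (1 + n) 1 + unitX _ 1 (2 * n + 1))
        + a (n + 1) • (unitX _ (2 + n) 3 + unitX _ (3 + n) 2)
  | .sp, n, a =>
      ∑ i ∈ Finset.Icc 1 (n - 1), a i • (unitX _ i (i + 1) + unitX _ (n + i + 1) (n + i))
  | .soEven, n, a =>
      ∑ i ∈ Finset.Icc 1 (n - 1), a i • (unitX _ i (i + 1) + unitX _ (n + i + 1) (n + i))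
        + a n • (unitX _ n (2 * n - 1) + unitX _ (n - 1) (2 * n))
        + a (n + 1) • (unitX _ (1 + n) 2 + unitX _ (2 + n) 1)

end Classical

/-! ### The quasigraded Lie algebra, its dual space and the pairing -/

section Loop

variable {𝕜 : Type*} [RCLike 𝕜] {N : ℕ}

/-- `A(λ) = 1 - λ A`. -/
def deform (A : Matrix (Fin N) (Fin N) 𝕜) : (Matrix (Fin N) (Fin N) 𝕜)[T;T⁻¹] :=
  1 - LaurentPolynomial.C A * LaurentPolynomial.T 1

/-- The deformed bracket `[X, Y]_{A(λ)} = X A(λ) Y - Y A(λ) X`, that is,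
`[X ⊗ p, Y ⊗ q] = (X Y - Y X) ⊗ p q - (X A Y - Y A X) ⊗ λ p q`. -/
def bracket (A : Matrix (Fin N) (Fin N) 𝕜) (X Y : (Matrix (Fin N) (Fin N) 𝕜)[T;T⁻¹]) :
    (Matrix (Fin N) (Fin N) 𝕜)[T;T⁻¹] :=
  X * deform A * Y - Y * deform A * X

/-- The pairing `⟨X(λ), L(λ)⟩ = res_{λ = 0} λ⁻¹ Tr (X(λ) L(λ))` of a Laurent polynomial with a
two-sided formal series `L(λ) = ∑ i, L i λ ^ i`. -/
def pairing (X : (Matrix (Fin N) (Fin N) 𝕜)[T;T⁻¹]) (L : ℤ → Matrix (Fin N) (Fin N) 𝕜) : 𝕜 :=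
  X.coeff.sum fun j x => Matrix.trace (x * L (-j))

/-- The product `P(λ) L(λ)` of a Laurent polynomial and a two-sided formal series. -/
def leftMul (P : (Matrix (Fin N) (Fin N) 𝕜)[T;T⁻¹]) (L : ℤ → Matrix (Fin N) (Fin N) 𝕜) :
    ℤ → Matrix (Fin N) (Fin N) 𝕜 :=
  fun i => P.coeff.sum fun j x => x * L (i - j)

/-- The product `L(λ) P(λ)` of a two-sided formal series and a Laurent polynomial. -/
def rightMul (L : ℤ → Matrix (Fin N) (Fin N) 𝕜) (P : (Matrix (Fin N) (Fin N) 𝕜)[T;T⁻¹]) :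
    ℤ → Matrix (Fin N) (Fin N) 𝕜 :=
  fun i => P.coeff.sum fun j x => L (i - j) * x

/-- The right-hand side `A(λ) M(λ) L(λ) - L(λ) M(λ) A(λ)` of the deformed Lax equation. -/
def laxRHS (A : Matrix (Fin N) (Fin N) 𝕜) (M : (Matrix (Fin N) (Fin N) 𝕜)[T;T⁻¹])
    (L : ℤ → Matrix (Fin N) (Fin N) 𝕜) : ℤ → Matrix (Fin N) (Fin N) 𝕜 :=
  leftMul (deform A * M) L - rightMul L (M * deform A)

end Loop

section Principal

variable (𝕜 : Type*) [RCLike 𝕜] (c : Series) (n : ℕ)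

/-- The space `⨁ j, 𝔤_j λ ^ j` underlying the principal quasigraded Lie algebra: its elements are
Laurent polynomials, the Lie bracket is `bracket A`. -/
def loopPr : Submodule 𝕜 (Mat c n 𝕜)[T;T⁻¹] where
  carrier := {X | ∀ j : ℤ, X.coeff j ∈ grade c n (j : ZMod (c.coxeter n))}
  zero_mem' := fun _ => Submodule.zero_mem _
  add_mem' := fun {X Y} hX hY j => by
    simpa using Submodule.add_mem _ (hX j) (hY j)
  smul_mem' := fun r X hX j => by
    simpa using Submodule.smul_mem _ r (hX j)

/-- The dual space, identified through `pairing` with the space of all two-sided formal series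
`∑ i, L i λ ^ i` with `L i ∈ 𝔤_i`. -/
def dualPr : Submodule 𝕜 (ℤ → Mat c n 𝕜) where
  carrier := {L | ∀ i : ℤ, L i ∈ grade c n (i : ZMod (c.coxeter n))}
  zero_mem' := fun _ => Submodule.zero_mem _
  add_mem' := fun {X Y} hX hY j => by
    simpa using Submodule.add_mem _ (hX j) (hY j)
  smul_mem' := fun r X hX j => by
    simpa using Submodule.smul_mem _ r (hX j)

end Principal

section Poisson

variable {𝕜 : Type*} [RCLike 𝕜] {c : Series} {n : ℕ}

/-- The linear coordinate function `L ↦ ⟨X, L⟩` on the dual space. -/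
def coordFn (X : loopPr 𝕜 c n) : dualPr 𝕜 c n → 𝕜 := fun L => pairing X.1 L.1

variable (𝕜 c n) in
/-- The algebra of polynomial functions (in finitely many coordinates) on the dual space. -/
def polyFn : Subalgebra 𝕜 (dualPr 𝕜 c n → 𝕜) :=
  Algebra.adjoin 𝕜 (Set.range coordFn)

/-- `M` is the gradient of the function `F` at `L`: the derivative of `F` at `L` in each
direction `Z` is `⟨M, Z⟩`. -/
def IsGradient (F : dualPr 𝕜 c n → 𝕜) (L : dualPr 𝕜 c n) (M : loopPr 𝕜 c n) : Prop :=
  ∀ Z : dualPr 𝕜 c n, HasDerivAt (fun r : 𝕜 => F (L + r • Z)) (coordFn M Z) 0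

open Classical in
/-- The gradient `∇F(L)`, an element of the algebra (with value `0` where no gradient exists). -/
def grad (F : dualPr 𝕜 c n → 𝕜) (L : dualPr 𝕜 c n) : loopPr 𝕜 c n :=
  if hF : ∃ M, IsGradient F L M then hF.choose else 0

/-- The Lie-Poisson bracket `{F, G}(L) = ⟨L, [∇F(L), ∇G(L)]_{A(λ)}⟩`. -/
def poisson (A : Mat c n 𝕜) (F G : dualPr 𝕜 c n → 𝕜) : dualPr 𝕜 c n → 𝕜 :=
  fun L => pairing (bracket A (grad F L).1 (grad G L).1) L.1

end Poisson

/-! ### The Hamiltonians and their flows -/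

/-- `plus` stands for `L⁺(λ)`, the part of `L(λ)` with powers `λ ^ i`, `i > 0`; `minus` stands for
`L⁻(λ)`, the part with powers `λ ^ i`, `i ≤ 0`. -/
inductive Half
  | plus
  | minus

/-- The powers of `λ` that occur in `L⁺` and in `L⁻`. -/
def Half.Mem : Half → ℤ → Prop
  | .plus, i => 0 < i
  | .minus, i => i ≤ 0

section Hamiltonian

variable {𝕜 : Type*} [RCLike 𝕜] {N : ℕ}

open Classical in
/-- The truncations `L⁺(λ)` and `L⁻(λ)` of `L(λ)`. -/
def halfPart (ε : Half) (L : ℤ → Matrix (Fin N) (Fin N) 𝕜) : ℤ → Matrix (Fin N) (Fin N) 𝕜 :=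
  fun i => if ε.Mem i then L i else 0

/-- The sign `σ` such that `λ ^ σ` is the local parameter of the expansions used for `L⁺`
(at `λ = 0`) and for `L⁻` (at `λ = ∞`). -/
def Half.sgn : Half → ℤ
  | .plus => 1
  | .minus => -1

/-- `L⁺(λ)` as a matrix over the formal Laurent series in `λ`, respectively `L⁻(λ)` as a matrix
over the formal Laurent series in `λ⁻¹`. -/
def halfSeries (ε : Half) (L : ℤ → Matrix (Fin N) (Fin N) 𝕜) :
    Matrix (Fin N) (Fin N) (LaurentSeries 𝕜) :=
  Matrix.of fun p q =>
    ((PowerSeries.mk fun i : ℕ => halfPart ε L (ε.sgn * i) p q : PowerSeries 𝕜) : LaurentSeries 𝕜)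

/-- `A(λ) = 1 - λ A` as a matrix over the formal Laurent series in the local parameter
(`λ` or `λ⁻¹`). Its determinant is a nonzero element of this field, so its inverse is the
expansion of `A(λ)⁻¹` at `0`, respectively at `∞`. -/
def deformSeries (ε : Half) (A : Matrix (Fin N) (Fin N) 𝕜) :
    Matrix (Fin N) (Fin N) (LaurentSeries 𝕜) :=
  1 - (HahnSeries.single ε.sgn (1 : 𝕜) : LaurentSeries 𝕜) • A.map HahnSeries.C

/-- `I^m_k = (1 / m) res_{λ = 0} λ^{-k-1} Tr (L(λ) A(λ)⁻¹)^m`, evaluated on `L^ε`: the coefficient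
of `λ ^ k` of the trace, divided by `m`. -/
def invariant (A : Matrix (Fin N) (Fin N) 𝕜) (ε : Half) (m : ℕ+) (k : ℤ)
    (L : ℤ → Matrix (Fin N) (Fin N) 𝕜) : 𝕜 :=
  (1 / (m : 𝕜)) *
    (Matrix.trace ((halfSeries ε L * (deformSeries ε A)⁻¹) ^ (m : ℕ))).coeff (ε.sgn * k)

end Hamiltonian

/-- The labels `(ε, m, k)` of the Hamiltonians `I^{m ε}_k` and of the times `t^{m ε}_k`. -/
abbrev Time := Half × ℕ+ × ℤ

section Flow

variable {𝕜 : Type*} [RCLike 𝕜] {c : Series} {n : ℕ}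

/-- The Hamiltonian `L ↦ I^m_k(L^ε)` on the dual space. -/
def ham (A : Mat c n 𝕜) (τ : Time) : dualPr 𝕜 c n → 𝕜 :=
  fun L => invariant A τ.1 τ.2.1 τ.2.2 L.1

/-- The curve `t ↦ L(t)` satisfies the Hamiltonian equations `∂ l / ∂ t = {l, H}`, for all
coordinate functions `l`, at the times `t ∈ U`. -/
def IsSolution {𝕋 : Type*} [RCLike 𝕋] [NormedAlgebra 𝕋 𝕜] (A : Mat c n 𝕜)
    (H : dualPr 𝕜 c n → 𝕜) (U : Set 𝕋) (L : 𝕋 → dualPr 𝕜 c n) : Prop :=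
  ∀ t ∈ U, ∀ X : loopPr 𝕜 c n,
    HasDerivAt (fun r : 𝕋 => coordFn X (L r)) (poisson A (coordFn X) H (L t)) t

/-- A joint formal trajectory, in all the times `t^{m ε}_k` at once, of the Hamiltonian flows: it
starts at `L₀`, and `Φ F` is the formal power series in the times that a polynomial function `F`
becomes along the trajectory; `∂ (Φ F) / ∂ t_τ = Φ {F, H_τ}` for every time `τ`. -/
def IsFormalFlow (A : Mat c n 𝕜) (L₀ : dualPr 𝕜 c n)
    (Φ : polyFn 𝕜 c n →ₐ[𝕜] MvPowerSeries Time 𝕜) : Prop :=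
  (∀ F : polyFn 𝕜 c n, MvPowerSeries.constantCoeff (Φ F) = F.1 L₀) ∧
  ∀ (τ : Time) (F G : polyFn 𝕜 c n), G.1 = poisson A F.1 (ham A τ) →
    MvPowerSeries.pderiv 𝕜 τ (Φ F) = Φ G

end Flow

end QuasigradedLie

end

open QuasigradedLie

open scoped LaurentPolynomial

noncomputable section

namespace QuasigradedLie

/-! A two-sided series cannot be multiplied with others, so `L⁺` and `L⁻` are treated separately, as
series in the local parameter at `λ = 0` or `λ = ∞`, where `A(λ)` is invertible. On the half `ε` put
`x = λ^{-k} A(λ)⁻¹ (L^ε A(λ)⁻¹)^{m-1}` (`gradExp`). Then `A(λ) x L^ε = L^ε x A(λ)`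
(`gradExp_commute`): `x` stabilizes `L^ε` under the coadjoint action of the deformed bracket.
Differentiating the trace of a power shows that the gradient of `I^m_k(L^ε)` is `x`, projected
coefficientwise to the spaces `𝔤_j` and cut down to the powers that pair with `L^ε`
(`isGradient_ham`). The projection respects the stabilizer equation because `A` has degree 1 and is
fixed by the anti-involution whose `-1`-eigenspace is `𝔤` (`deformed_commutator_gradeExp`).

For the involution (`poisson_ham_ham`), split `⟨[M, M'], L⟩` into its values on `L⁺` and `L⁻`. On
the half `ε`, the gradient of a Hamiltonian of that half is `w - o` with `w` a stabilizer and `o` in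
the annihilator of the half. The gradient of a Hamiltonian of the other half lies in the annihilator
itself. A stabilizer contributes zero by cyclicity of the trace, and the annihilator is closed under
the bracket, so all combinations vanish.

The rest is formal. The Lax form is cyclicity of the trace (`pairing_bracket`). The Jacobi identity
(`hamDer_jacobi`) turns involution into commuting derivations, whose joint Taylor series is the
formal flow (`existsUnique_formalFlow`). A polynomial with vanishing bracket has zero derivative
along solutions. -/

section Projection

/-! ### The anti-involution, the principal grading, and the projections onto the graded pieces. -/

/-- The involution of the (zero-based) indices which is defined by the invariant form. -/
def partnerVal : Series → ℕ → ℕ → ℕ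
  | .gl, _, i => i
  | .soOdd, n, i => if i = 0 then 0 else if i ≤ n then i + n else i - n
  | .sp, n, i => if i < n then i + n else i - n
  | .soEven, n, i => if i < n then i + n else i - n

lemma partnerVal_lt (c : Series) (n i : ℕ) (h : i < c.size n) : partnerVal c n i < c.size n := by
  cases c <;> simp only [Series.size, partnerVal] at * <;> (try split_ifs) <;> omega

lemma partnerVal_partnerVal (c : Series) (n i : ℕ) (h : i < c.size n) :
    partnerVal c n (partnerVal c n i) = i := by
  cases c <;> simp only [Series.size, partnerVal] at * <;> (try split_ifs) <;> omega

/-- The involution of the indices which is defined by the invariant form. -/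
def partner (c : Series) (n : ℕ) (i : Fin (c.size n)) : Fin (c.size n) :=
  ⟨partnerVal c n i, partnerVal_lt c n i i.2⟩

@[simp] lemma partner_partner (c : Series) (n : ℕ) (i : Fin (c.size n)) :
    partner c n (partner c n i) = i :=
  Fin.ext (partnerVal_partnerVal c n i i.2)

variable {𝕜 : Type*} [RCLike 𝕜]

variable (𝕜) in
/-- The nonzero entry in the row `i` of the matrix of the invariant form. -/
def formEntry (c : Series) (n : ℕ) (i : ℕ) : 𝕜 :=
  match c with
  | .sp => if i < n then 1 else -1
  | _ => 1

lemma formEntry_mul_self (c : Series) (n i : ℕ) : formEntry 𝕜 c n i * formEntry 𝕜 c n i = 1 := by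
  cases c <;> simp only [formEntry] <;> (try split_ifs) <;> simp

/-- The anti-automorphism of the algebra of matrices whose `-1`-eigenspace is the Lie algebra. -/
def antiInvol (c : Series) (n : ℕ) : Mat c n 𝕜 →ₗ[𝕜] Mat c n 𝕜 where
  toFun X := Matrix.of fun i j =>
    formEntry 𝕜 c n i * formEntry 𝕜 c n j * X (partner c n j) (partner c n i)
  map_add' X Y := by ext i j; simp [mul_add]
  map_smul' r X := by ext i j; simp; ring

lemma antiInvol_apply (c : Series) (n : ℕ) (X : Mat c n 𝕜) (i j : Fin (c.size n)) :
    antiInvol c n X i j =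
      formEntry 𝕜 c n i * formEntry 𝕜 c n j * X (partner c n j) (partner c n i) := rfl

lemma sum_partner {M : Type*} [AddCommMonoid M] (c : Series) (n : ℕ) (f : Fin (c.size n) → M) :
    ∑ i, f (partner c n i) = ∑ i, f i :=
  Fintype.sum_bijective (partner c n)
    (Function.Involutive.bijective (partner_partner c n)) _ _ fun _ => rfl

lemma antiInvol_mul (c : Series) (n : ℕ) (X Y : Mat c n 𝕜) :
    antiInvol c n (X * Y) = antiInvol c n Y * antiInvol c n X := by
  ext i j
  simp only [antiInvol_apply, Matrix.mul_apply]
  rw [← sum_partner, Finset.mul_sum]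
  refine Finset.sum_congr rfl fun a _ => ?_
  linear_combination -(formEntry 𝕜 c n i * formEntry 𝕜 c n j * X (partner c n j) (partner c n a) *
    Y (partner c n a) (partner c n i)) * formEntry_mul_self (𝕜 := 𝕜) c n a

variable (𝕜) in
/-- The sign of the invariant form: `1` if it is symmetric, `-1` if it is antisymmetric. -/
def formSign : Series → 𝕜
  | .sp => -1
  | _ => 1

lemma formSign_mul_self (c : Series) : formSign 𝕜 c * formSign 𝕜 c = 1 := by
  cases c <;> simp [formSign]

lemma formEntry_partnerVal {c : Series} {n i : ℕ} (h : i < c.size n) :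
    formEntry 𝕜 c n (partnerVal c n i) = formSign 𝕜 c * formEntry 𝕜 c n i := by
  cases c with
  | sp =>
    simp only [formEntry, partnerVal, Series.size, formSign] at *
    split_ifs <;> first | omega | simp
  | _ => simp [formEntry, formSign]

lemma formEntry_partner (c : Series) (n : ℕ) (i j : Fin (c.size n)) :
    formEntry 𝕜 c n (partner c n i) * formEntry 𝕜 c n (partner c n j) =
      formEntry 𝕜 c n i * formEntry 𝕜 c n j := by
  change formEntry 𝕜 c n (partnerVal c n i) * formEntry 𝕜 c n (partnerVal c n j) = _
  rw [formEntry_partnerVal i.2, formEntry_partnerVal j.2]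
  linear_combination formEntry 𝕜 c n i * formEntry 𝕜 c n j * formSign_mul_self (𝕜 := 𝕜) c

lemma antiInvol_antiInvol (c : Series) (n : ℕ) (X : Mat c n 𝕜) :
    antiInvol c n (antiInvol c n X) = X := by
  ext i j
  simp only [antiInvol_apply, partner_partner]
  rw [formEntry_partner]
  linear_combination X i j * (formEntry 𝕜 c n j * formEntry 𝕜 c n j) * formEntry_mul_self (𝕜 := 𝕜) c n i
    + X i j * formEntry_mul_self (𝕜 := 𝕜) c n j

lemma trace_antiInvol (c : Series) (n : ℕ) (X : Mat c n 𝕜) :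
    Matrix.trace (antiInvol c n X) = Matrix.trace X := by
  simp only [Matrix.trace, Matrix.diag, antiInvol_apply, formEntry_mul_self, one_mul]
  exact sum_partner c n fun i => X i i

/-- Each form matrix `S` has one nonzero entry per row, in the column given by `partner`, so `S Xᵀ
S` is `antiInvol` up to the sign of the form. The symplectic sign accounts for the missing minus in
`X = w Xᵀ w`, so all three series become the same eigenspace condition. -/
lemma isClassical_iff {c : Series} (hc : c ≠ .gl) (n : ℕ) (X : Mat c n 𝕜) :
    IsClassical c n X ↔ antiInvol c n X = -X := by
  have key : ∀ S : Mat c n 𝕜, (∀ i j, S i j = if (j : ℕ) = partnerVal c n i then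
      formEntry 𝕜 c n i else 0) → S * X.transpose * S = formSign 𝕜 c • antiInvol c n X := by
    intro S hS
    have hS' : ∀ i j, S i j = if j = partner c n i then formEntry 𝕜 c n i else 0 := fun i j => by
      rw [hS]; simp only [Fin.ext_iff]; rfl
    ext i j
    have h3 : ∀ b, S b j = if b = partner c n j then formSign 𝕜 c * formEntry 𝕜 c n j else 0 := by
      intro b
      rw [hS']
      by_cases h : b = partner c n j
      · rw [if_pos h, if_pos (by rw [h, partner_partner]), h]
        exact formEntry_partnerVal j.2
      · rw [if_neg h, if_neg]
        rintro rfl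
        exact h (partner_partner c n b).symm
    simp only [Matrix.mul_apply, hS' i, h3, Matrix.transpose_apply, ite_mul, zero_mul, mul_ite,
      mul_zero, Finset.sum_ite_eq', Finset.mem_univ, if_true, Matrix.smul_apply, smul_eq_mul,
      antiInvol_apply]
    ring
  have hneg : X = -antiInvol c n X ↔ antiInvol c n X = -X := by
    rw [eq_neg_iff_add_eq_zero, eq_neg_iff_add_eq_zero, add_comm]
  cases c with
  | gl => exact absurd rfl hc
  | soOdd =>
    rw [IsClassical, key (formOdd n), show formSign 𝕜 .soOdd = 1 from rfl, one_smul, hneg]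
    intro i j
    have hi : (i : ℕ) < 2 * n + 1 := i.2
    have hj : (j : ℕ) < 2 * n + 1 := j.2
    simp only [formOdd, Matrix.of_apply, partnerVal, formEntry]
    split_ifs <;> first | rfl | omega
  | sp =>
    rw [IsClassical, key (formSp n), formSign, neg_one_smul, hneg]
    intro i j
    have hi : (i : ℕ) < 2 * n := i.2
    have hj : (j : ℕ) < 2 * n := j.2
    simp only [formSp, Matrix.of_apply, partnerVal, formEntry]
    split_ifs <;> first | rfl | omega
  | soEven =>
    rw [IsClassical, key (formEven n), show formSign 𝕜 .soEven = 1 from rfl, one_smul, hneg]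
    intro i j
    have hi : (i : ℕ) < 2 * n := i.2
    have hj : (j : ℕ) < 2 * n := j.2
    simp only [formEven, Matrix.of_apply, partnerVal, formEntry]
    split_ifs <;> first | rfl | omega

/-- The height modulo `h` of the matrix unit at `(i, j)`. -/
def height (c : Series) (n : ℕ) (i j : Fin (c.size n)) : ZMod (c.coxeter n) :=
  ((wt c n (i + 1) - wt c n (j + 1) : ℤ) : ZMod (c.coxeter n))

lemma height_add (c : Series) (n : ℕ) (i j k : Fin (c.size n)) :
    height c n i j + height c n j k = height c n i k := by
  rw [height, height, height, ← Int.cast_add]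
  congr 1
  ring

lemma height_swap (c : Series) (n : ℕ) (i j : Fin (c.size n)) :
    height c n i j = -height c n j i := by
  rw [height, height, ← Int.cast_neg, neg_sub]

/-- Paired indices have weights of constant sum, read off here at index 0. Hence reversing and
pairing the indices of a matrix unit preserves its height, and `antiInvol` preserves the grading. -/
lemma wt_partnerVal {c : Series} (hc : c ≠ .gl) {n i : ℕ} (h : i < c.size n) :
    wt c n (partnerVal c n i + 1) = (wt c n (partnerVal c n 0 + 1) + wt c n 1) - wt c n (i + 1) := by
  cases c with
  | gl => exact absurd rfl hc
  | _ =>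
    simp only [partnerVal, wt, Series.size] at *
    split_ifs <;> push_cast <;> omega

lemma height_partner {c : Series} (hc : c ≠ .gl) (n : ℕ) (i j : Fin (c.size n)) :
    height c n (partner c n j) (partner c n i) = height c n i j := by
  unfold height
  congr 1
  change wt c n (partnerVal c n j + 1) - wt c n (partnerVal c n i + 1) = _
  rw [wt_partnerVal hc i.2, wt_partnerVal hc j.2]
  ring

/-- The homogeneous component of degree `j` of a matrix, in the principal grading. -/
def homProj (c : Series) (n : ℕ) (j : ZMod (c.coxeter n)) : Mat c n 𝕜 →ₗ[𝕜] Mat c n 𝕜 where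
  toFun X := Matrix.of fun a b => if height c n a b = j then X a b else 0
  map_add' X Y := by ext a b; simp only [Matrix.of_apply, Matrix.add_apply]; split_ifs <;> simp
  map_smul' r X := by ext a b; simp

lemma homProj_apply (c : Series) (n : ℕ) (j : ZMod (c.coxeter n)) (X : Mat c n 𝕜)
    (a b : Fin (c.size n)) : homProj c n j X a b = if height c n a b = j then X a b else 0 := rfl

/-- `X` is homogeneous of degree `j` in the principal grading. -/
def IsHom (c : Series) (n : ℕ) (j : ZMod (c.coxeter n)) (X : Mat c n 𝕜) : Prop :=
  ∀ a b, height c n a b ≠ j → X a b = 0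

lemma homProj_mul_left {c : Series} {n : ℕ} {i : ZMod (c.coxeter n)} {L : Mat c n 𝕜}
    (hL : IsHom c n i L) (j : ZMod (c.coxeter n)) (X : Mat c n 𝕜) :
    homProj c n (i + j) (L * X) = L * homProj c n j X := by
  ext a b
  simp only [homProj_apply, Matrix.mul_apply, mul_ite, mul_zero]
  have : (if height c n a b = i + j then ∑ x, L a x * X x b else 0) =
    ∑ x, if height c n a b = i + j then L a x * X x b else 0 := by split_ifs <;> simp
  rw [this]
  refine Finset.sum_congr rfl fun x _ => ?_
  by_cases h : height c n a x = i
  · have h2 : height c n a b = i + j ↔ height c n x b = j := by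
      rw [← height_add c n a x b, h, add_right_inj]
    simp only [h2]
  · simp [hL a x h]

lemma homProj_mul_right {c : Series} {n : ℕ} {i : ZMod (c.coxeter n)} {L : Mat c n 𝕜}
    (hL : IsHom c n i L) (j : ZMod (c.coxeter n)) (X : Mat c n 𝕜) :
    homProj c n (i + j) (X * L) = homProj c n j X * L := by
  ext a b
  simp only [homProj_apply, Matrix.mul_apply, ite_mul, zero_mul]
  have : (if height c n a b = i + j then ∑ x, X a x * L x b else 0) =
    ∑ x, if height c n a b = i + j then X a x * L x b else 0 := by split_ifs <;> simp
  rw [this]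
  refine Finset.sum_congr rfl fun x _ => ?_
  by_cases h : height c n x b = i
  · have h2 : height c n a b = i + j ↔ height c n a x = j := by
      rw [← height_add c n a x b, h, add_comm, add_right_inj]
    simp only [h2]
  · simp [hL x b h]

lemma trace_homProj_mul (c : Series) (n : ℕ) (j : ZMod (c.coxeter n)) (X Y : Mat c n 𝕜) :
    Matrix.trace (homProj c n j X * Y) = Matrix.trace (X * homProj c n (-j) Y) := by
  simp only [Matrix.trace, Matrix.diag, Matrix.mul_apply, homProj_apply]
  refine Finset.sum_congr rfl fun a _ => Finset.sum_congr rfl fun b _ => ?_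
  have : height c n b a = -j ↔ height c n a b = j := by rw [height_swap, neg_inj]
  simp only [this]
  split_ifs <;> simp

lemma homProj_antiInvol {c : Series} (hc : c ≠ .gl) (n : ℕ) (j : ZMod (c.coxeter n))
    (X : Mat c n 𝕜) : homProj c n j (antiInvol c n X) = antiInvol c n (homProj c n j X) := by
  ext a b
  simp only [homProj_apply, antiInvol_apply, height_partner hc]
  split_ifs <;> simp

open Classical in
/-- The projection of the space of matrices onto the classical Lie algebra. -/
def classicalProj (c : Series) (n : ℕ) : Mat c n 𝕜 →ₗ[𝕜] Mat c n 𝕜 :=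
  if c = .gl then LinearMap.id else (1 / 2 : 𝕜) • (LinearMap.id - antiInvol c n)

/-- The projection of the space of matrices onto the component `𝔤_j` of the principal grading. -/
def gradeProj (c : Series) (n : ℕ) (j : ZMod (c.coxeter n)) : Mat c n 𝕜 →ₗ[𝕜] Mat c n 𝕜 :=
  homProj c n j ∘ₗ classicalProj c n

lemma isHom_of_mem_grade {c : Series} {n : ℕ} {j : ZMod (c.coxeter n)} {X : Mat c n 𝕜}
    (hX : X ∈ grade c n j) : IsHom c n j X := hX.2

lemma classical_of_mem_grade {c : Series} {n : ℕ} {j : ZMod (c.coxeter n)} {X : Mat c n 𝕜}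
    (hc : c ≠ .gl) (hX : X ∈ grade c n j) : antiInvol c n X = -X :=
  (isClassical_iff hc n X).1 hX.1

lemma homProj_eq_self {c : Series} {n : ℕ} {j : ZMod (c.coxeter n)} {X : Mat c n 𝕜}
    (hX : IsHom c n j X) : homProj c n j X = X := by
  ext a b
  rw [homProj_apply]
  split_ifs with h
  · rfl
  · exact (hX a b h).symm

lemma gradeProj_mem (c : Series) (n : ℕ) (j : ZMod (c.coxeter n)) (X : Mat c n 𝕜) :
    gradeProj c n j X ∈ grade c n j := by
  refine ⟨?_, fun a b h => if_neg h⟩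
  change IsClassical c n _
  by_cases hc : c = .gl
  · subst hc; trivial
  · rw [isClassical_iff hc, gradeProj, LinearMap.comp_apply, ← homProj_antiInvol hc,
      ← map_neg]
    congr 1
    simp only [classicalProj, if_neg hc, LinearMap.smul_apply, LinearMap.sub_apply,
      LinearMap.id_apply, map_smul, map_sub, antiInvol_antiInvol]
    rw [← smul_neg, neg_sub]

lemma gradeProj_eq_self {c : Series} {n : ℕ} {j : ZMod (c.coxeter n)} {X : Mat c n 𝕜}
    (hX : X ∈ grade c n j) : gradeProj c n j X = X := by
  rw [gradeProj, LinearMap.comp_apply]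
  have : classicalProj c n X = X := by
    by_cases hc : c = .gl
    · rw [classicalProj, if_pos hc, LinearMap.id_apply]
    · simp only [classicalProj, if_neg hc, LinearMap.smul_apply, LinearMap.sub_apply,
        LinearMap.id_apply, classical_of_mem_grade hc hX, sub_neg_eq_add, smul_add]
      rw [← add_smul]; norm_num
  rw [this, homProj_eq_self (isHom_of_mem_grade hX)]

/-- Degree `j` pairs only with degree `-j`, and `antiInvol` is an involutive anti-automorphism that
preserves traces. So projecting a matrix does not change its pairing with elements of `𝔤_{-j}`. -/
lemma trace_gradeProj_mul (c : Series) (n : ℕ) (j : ZMod (c.coxeter n)) (X Y : Mat c n 𝕜) :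
    Matrix.trace (gradeProj c n j X * Y) = Matrix.trace (X * gradeProj c n (-j) Y) := by
  rw [gradeProj, gradeProj, LinearMap.comp_apply, LinearMap.comp_apply, trace_homProj_mul]
  by_cases hc : c = .gl
  · simp [classicalProj, hc]
  · simp only [classicalProj, if_neg hc, LinearMap.smul_apply, LinearMap.sub_apply,
        LinearMap.id_apply, map_smul, map_sub, Matrix.smul_mul, Matrix.mul_smul, Matrix.sub_mul,
        Matrix.mul_sub, Matrix.trace_smul, Matrix.trace_sub, homProj_antiInvol hc]
    rw [← trace_antiInvol c n (antiInvol c n X * _), antiInvol_mul, antiInvol_antiInvol,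
      Matrix.trace_mul_comm _ X]

variable {c : Series} {n : ℕ} {i : ZMod (c.coxeter n)} {L : Mat c n 𝕜}

/-- For `L` in `𝔤_i` the anti-involution commutes with `M ↦ M L - L M`: it reverses the products and
changes the sign of `L`. The degree is shifted by `i`. -/
lemma gradeProj_commutator (hL : L ∈ grade c n i) (j : ZMod (c.coxeter n)) (M : Mat c n 𝕜) :
    gradeProj c n (i + j) (M * L - L * M) = gradeProj c n j M * L - L * gradeProj c n j M := by
  have hL' := isHom_of_mem_grade hL
  simp only [gradeProj, LinearMap.comp_apply]
  rw [← homProj_mul_left hL', ← homProj_mul_right hL', ← map_sub]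
  congr 1
  by_cases hc : c = .gl
  · simp [classicalProj, hc]
  · simp only [classicalProj, if_neg hc, LinearMap.smul_apply, LinearMap.sub_apply,
        LinearMap.id_apply, map_sub, antiInvol_mul, classical_of_mem_grade hc hL, Matrix.mul_neg,
        Matrix.neg_mul, Matrix.smul_mul, Matrix.mul_smul, Matrix.sub_mul, Matrix.mul_sub]
    module

/-- What the proofs need to know about the deformation matrix. -/
structure IsDeformation (A : Mat c n 𝕜) : Prop where
  isHom : IsHom c n 1 A
  antiInvol_eq : c ≠ .gl → antiInvol c n A = A

variable {A : Mat c n 𝕜}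

/-- As for the commutator: the anti-involution exchanges `A M L` with `-L M' A`, where `M'` is the
image of `M`, because it fixes `A` and negates `L`. The extra 1 is the degree of `A`. -/
lemma gradeProj_deformed (hA : IsDeformation A) (hL : L ∈ grade c n i) (j : ZMod (c.coxeter n))
    (M : Mat c n 𝕜) : gradeProj c n (i + j + 1) (A * M * L - L * M * A) =
      A * gradeProj c n j M * L - L * gradeProj c n j M * A := by
  have hL' := isHom_of_mem_grade hL
  simp only [gradeProj, LinearMap.comp_apply]
  rw [← homProj_mul_left hL', ← homProj_mul_left hA.isHom, ← homProj_mul_right hL',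
    ← homProj_mul_right hA.isHom, add_comm (i + j) 1,
    show i + (1 + j) = 1 + (i + j) by ring, ← map_sub]
  congr 1
  by_cases hc : c = .gl
  · simp [classicalProj, hc]
  · simp only [classicalProj, if_neg hc, LinearMap.smul_apply, LinearMap.sub_apply,
        LinearMap.id_apply, map_sub, antiInvol_mul, classical_of_mem_grade hc hL, Matrix.mul_neg,
        Matrix.neg_mul, Matrix.smul_mul, Matrix.mul_smul, Matrix.sub_mul, Matrix.mul_sub,
        hA.antiInvol_eq hc, Matrix.mul_assoc]
    module

lemma gradeProj_bracket (hA : IsDeformation A) (hL : L ∈ grade c n i) (j : ZMod (c.coxeter n))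
    (M : Mat c n 𝕜) : gradeProj c n (i + j + 1) (L * A * M - M * A * L) =
      L * A * gradeProj c n j M - gradeProj c n j M * A * L := by
  have hL' := isHom_of_mem_grade hL
  have h1 (X : Mat c n 𝕜) : L * A * homProj c n j X = homProj c n (i + (1 + j)) (L * A * X) := by
    rw [Matrix.mul_assoc L A X, homProj_mul_left hL', homProj_mul_left hA.isHom, Matrix.mul_assoc]
  have h2 (X : Mat c n 𝕜) : homProj c n j X * A * L = homProj c n (i + (1 + j)) (X * A * L) := by
    rw [homProj_mul_right hL', homProj_mul_right hA.isHom]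
  simp only [gradeProj, LinearMap.comp_apply]
  rw [h1, h2, add_assoc i j 1, add_comm j 1, ← map_sub]
  congr 1
  by_cases hc : c = .gl
  · simp [classicalProj, hc, Matrix.mul_assoc]
  · simp only [classicalProj, if_neg hc, LinearMap.smul_apply, LinearMap.sub_apply,
        LinearMap.id_apply, map_sub, antiInvol_mul, classical_of_mem_grade hc hL, Matrix.mul_neg,
        Matrix.neg_mul, Matrix.smul_mul, Matrix.mul_smul, Matrix.sub_mul, Matrix.mul_sub,
        hA.antiInvol_eq hc, Matrix.mul_assoc]
    module

end Projection

/-! ### The deformation matrix has degree 1 and is fixed by the anti-involution. -/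

section DeformationMatrix

variable {𝕜 : Type*} [RCLike 𝕜]

lemma unitX_apply {N : ℕ} (p q : ℕ) (i j : Fin N) :
    (unitX N p q : Matrix (Fin N) (Fin N) 𝕜) i j =
      if (i : ℕ) + 1 = p ∧ (j : ℕ) + 1 = q then 1 else 0 := rfl

lemma isHom_unitX {c : Series} {n p q : ℕ} {k : ZMod (c.coxeter n)}
    (h : ((wt c n p - wt c n q : ℤ) : ZMod (c.coxeter n)) = k) :
    IsHom c n k (unitX _ p q : Mat c n 𝕜) := by
  intro i j hij
  rw [unitX_apply, if_neg]
  rintro ⟨rfl, rfl⟩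
  exact hij h

lemma IsHom.add {c : Series} {n : ℕ} {k : ZMod (c.coxeter n)} {X Y : Mat c n 𝕜}
    (hX : IsHom c n k X) (hY : IsHom c n k Y) : IsHom c n k (X + Y) := fun a b h => by
  rw [Matrix.add_apply, hX a b h, hY a b h, add_zero]

lemma IsHom.smul {c : Series} {n : ℕ} {k : ZMod (c.coxeter n)} {X : Mat c n 𝕜} (r : 𝕜)
    (hX : IsHom c n k X) : IsHom c n k (r • X) := fun a b h => by
  rw [Matrix.smul_apply, hX a b h, smul_zero]

lemma IsHom.sum {c : Series} {n : ℕ} {k : ZMod (c.coxeter n)} {ι : Type*} {s : Finset ι}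
    {X : ι → Mat c n 𝕜} (hX : ∀ i ∈ s, IsHom c n k (X i)) : IsHom c n k (∑ i ∈ s, X i) :=
  fun a b h => by
    rw [Matrix.sum_apply]
    exact Finset.sum_eq_zero fun i hi => hX i hi a b h

/-- The anti-involution exchanges the two matrix units. Equality of the form entries at `p` and `q`
makes the exchange free of signs. -/
lemma antiInvol_unitX_add {c : Series} {n p q p' q' : ℕ}
    (hp : 1 ≤ p ∧ p ≤ c.size n) (hq : 1 ≤ q ∧ q ≤ c.size n)
    (hp' : p' = partnerVal c n (q - 1) + 1) (hq' : q' = partnerVal c n (p - 1) + 1)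
    (hs : formEntry 𝕜 c n (p - 1) = formEntry 𝕜 c n (q - 1)) :
    antiInvol c n (unitX _ p q + unitX _ p' q' : Mat c n 𝕜) = unitX _ p q + unitX _ p' q' := by
  have key : antiInvol c n (unitX _ p q : Mat c n 𝕜) = unitX _ p' q' := by
    ext i j
    have h1 : (partner c n j : ℕ) + 1 = p ↔ (j : ℕ) + 1 = q' := by
      constructor
      · intro h
        rw [hq', ← h, Nat.add_sub_cancel]
        exact congrArg (· + 1) (congrArg Fin.val (partner_partner c n j)).symm
      · intro h
        have : (j : ℕ) = partnerVal c n (p - 1) := by omega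
        change partnerVal c n j + 1 = p
        rw [this, partnerVal_partnerVal c n _ (by omega)]
        omega
    have h2 : (partner c n i : ℕ) + 1 = q ↔ (i : ℕ) + 1 = p' := by
      constructor
      · intro h
        rw [hp', ← h, Nat.add_sub_cancel]
        exact congrArg (· + 1) (congrArg Fin.val (partner_partner c n i)).symm
      · intro h
        have : (i : ℕ) = partnerVal c n (q - 1) := by omega
        change partnerVal c n i + 1 = q
        rw [this, partnerVal_partnerVal c n _ (by omega)]
        omega
    rw [antiInvol_apply, unitX_apply, unitX_apply]
    simp only [h1, h2, and_comm (a := (j : ℕ) + 1 = q')]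
    split_ifs with h
    · rw [← h1, ← h2] at h
      rw [← formEntry_partner, show (partner c n i : ℕ) = q - 1 by omega,
        show (partner c n j : ℕ) = p - 1 by omega, hs, formEntry_mul_self, one_mul]
    · rw [mul_zero]
  rw [map_add, key, ← key, antiInvol_antiInvol, add_comm]

lemma wt_cast {c : Series} {n : ℕ} {x y : ℤ} (k : ℤ) (h : x = y + k * (c.coxeter n : ℕ)) :
    (x : ZMod (c.coxeter n)) = (y : ZMod (c.coxeter n)) := by
  rw [h]; push_cast; simp

lemma isDeformation_deformationMatrix (c : Series) (n : ℕ) (hn : c.minRank ≤ n) (a : ℕ → 𝕜) :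
    IsDeformation (deformationMatrix c n a) := by
  -- `k` counts the Coxeter numbers by which the height differs from 1: it is 0 for most terms of
  -- `A`, and -1 for the term with the last parameter in `gl` and the orthogonal series, whose
  -- height is `1 - h`.
  have w : ∀ {p q : ℕ} (k : ℤ), wt c n p - wt c n q = 1 + k * (c.coxeter n : ℕ) →
      IsHom c n 1 (unitX _ p q : Mat c n 𝕜) := fun k h =>
    isHom_unitX (by rw [wt_cast k h, Int.cast_one])
  cases c with
  | gl =>
    simp only [Series.minRank] at hn
    refine ⟨?_, fun h => absurd rfl h⟩
    refine (IsHom.sum fun i hi => (w 0 ?_).smul _).add ((w (-1) ?_).smul _)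
    · simp only [wt]; push_cast; ring
    · simp only [wt, Series.coxeter]; push_cast; ring
  | soOdd =>
    simp only [Series.minRank] at hn
    constructor
    · refine ((IsHom.sum fun i hi => (IsHom.add (w 0 ?_) (w 0 ?_)).smul _).add
        ((IsHom.add (w 0 ?_) (w 0 ?_)).smul _)).add ((IsHom.add (w (-1) ?_) (w (-1) ?_)).smul _)
      all_goals
        (try rw [Finset.mem_Icc] at hi)
        simp only [wt, Series.coxeter]; split_ifs <;> push_cast <;> omega
    · intro _
      simp only [deformationMatrix]
      rw [map_add, map_add, map_sum]
      simp only [map_smul]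
      congr 2
      · refine Finset.sum_congr rfl fun i hi => ?_
        rw [Finset.mem_Icc] at hi
        rw [antiInvol_unitX_add]
        all_goals
          simp only [partnerVal, Series.size, formEntry] <;> (try split_ifs) <;> first | rfl | omega
      all_goals
        rw [antiInvol_unitX_add]
        all_goals
          simp only [partnerVal, Series.size, formEntry] <;> (try split_ifs) <;>
            first | rfl | contradiction | omega
  | sp =>
    simp only [Series.minRank] at hn
    constructor
    · refine IsHom.sum fun i hi => (IsHom.add (w 0 ?_) (w 0 ?_)).smul _
      all_goals
        rw [Finset.mem_Icc] at hi
        simp only [wt, Series.coxeter]; split_ifs <;> push_cast <;> omega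
    · intro _
      simp only [deformationMatrix, map_sum, map_smul]
      refine Finset.sum_congr rfl fun i hi => ?_
      rw [Finset.mem_Icc] at hi
      rw [antiInvol_unitX_add]
      all_goals
        simp only [partnerVal, Series.size, formEntry]; (try split_ifs) <;> first | rfl | omega
  | soEven =>
    simp only [Series.minRank] at hn
    constructor
    · refine ((IsHom.sum fun i hi => (IsHom.add (w 0 ?_) (w 0 ?_)).smul _).add
        ((IsHom.add (w 0 ?_) (w 0 ?_)).smul _)).add ((IsHom.add (w (-1) ?_) (w (-1) ?_)).smul _)
      all_goals
        (try rw [Finset.mem_Icc] at hi)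
        simp only [wt, Series.coxeter]; split_ifs <;> push_cast <;> omega
    · intro _
      simp only [deformationMatrix]
      rw [map_add, map_add, map_sum]
      simp only [map_smul]
      congr 2
      · refine Finset.sum_congr rfl fun i hi => ?_
        rw [Finset.mem_Icc] at hi
        rw [antiInvol_unitX_add]
        all_goals
          simp only [partnerVal, Series.size, formEntry] <;> (try split_ifs) <;> first | rfl | omega
      all_goals
        rw [antiInvol_unitX_add]
        all_goals
          simp only [partnerVal, Series.size, formEntry] <;> (try split_ifs) <;> first | rfl | omega

end DeformationMatrix

/-! ### The pairing, multiplication operators and the deformed bracket on Laurent polynomials. -/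

section Pairing

variable {𝕜 : Type*} [RCLike 𝕜] {N : ℕ}

/-- The monomial `x λ ^ j`. -/
abbrev monom (j : ℤ) (x : Matrix (Fin N) (Fin N) 𝕜) : (Matrix (Fin N) (Fin N) 𝕜)[T;T⁻¹] :=
  AddMonoidAlgebra.single j x

lemma pairing_monom (j : ℤ) (x : Matrix (Fin N) (Fin N) 𝕜) (L : ℤ → Matrix (Fin N) (Fin N) 𝕜) :
    pairing (monom j x) L = Matrix.trace (x * L (-j)) := by
  rw [pairing, AddMonoidAlgebra.coeff_single, Finsupp.sum_single_index (by simp)]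

lemma pairing_add_left (X Y : (Matrix (Fin N) (Fin N) 𝕜)[T;T⁻¹])
    (L : ℤ → Matrix (Fin N) (Fin N) 𝕜) : pairing (X + Y) L = pairing X L + pairing Y L := by
  rw [pairing, AddMonoidAlgebra.coeff_add, Finsupp.sum_add_index' (by simp)
    (by simp [Matrix.add_mul])]
  rfl

lemma pairing_zero_left (L : ℤ → Matrix (Fin N) (Fin N) 𝕜) : pairing 0 L = 0 := by
  simp [pairing]

lemma pairing_neg_left (X : (Matrix (Fin N) (Fin N) 𝕜)[T;T⁻¹])
    (L : ℤ → Matrix (Fin N) (Fin N) 𝕜) : pairing (-X) L = -pairing X L := by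
  rw [eq_neg_iff_add_eq_zero, ← pairing_add_left, neg_add_cancel, pairing_zero_left]

lemma pairing_sub_left (X Y : (Matrix (Fin N) (Fin N) 𝕜)[T;T⁻¹])
    (L : ℤ → Matrix (Fin N) (Fin N) 𝕜) : pairing (X - Y) L = pairing X L - pairing Y L := by
  rw [sub_eq_add_neg, pairing_add_left, pairing_neg_left, sub_eq_add_neg]

lemma pairing_add_right (X : (Matrix (Fin N) (Fin N) 𝕜)[T;T⁻¹])
    (L L' : ℤ → Matrix (Fin N) (Fin N) 𝕜) : pairing X (L + L') = pairing X L + pairing X L' := by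
  simp [pairing, Matrix.mul_add, Finsupp.sum_add]

lemma pairing_sub_right (X : (Matrix (Fin N) (Fin N) 𝕜)[T;T⁻¹])
    (L L' : ℤ → Matrix (Fin N) (Fin N) 𝕜) : pairing X (L - L') = pairing X L - pairing X L' := by
  simp [pairing, Matrix.mul_sub, Finsupp.sum_sub]

lemma pairing_smul_left (r : 𝕜) (X : (Matrix (Fin N) (Fin N) 𝕜)[T;T⁻¹])
    (L : ℤ → Matrix (Fin N) (Fin N) 𝕜) : pairing (r • X) L = r * pairing X L := by
  rw [pairing, AddMonoidAlgebra.coeff_smul, Finsupp.sum_smul_index' (by simp), pairing,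
    Finsupp.mul_sum]
  simp

lemma pairing_smul_right (r : 𝕜) (X : (Matrix (Fin N) (Fin N) 𝕜)[T;T⁻¹])
    (L : ℤ → Matrix (Fin N) (Fin N) 𝕜) : pairing X (r • L) = r * pairing X L := by
  simp [pairing, Finsupp.mul_sum]

lemma pairing_eq_sum_trace (X : (Matrix (Fin N) (Fin N) 𝕜)[T;T⁻¹])
    (L : ℤ → Matrix (Fin N) (Fin N) 𝕜) {s : Finset ℤ} (hs : X.coeff.support ⊆ s) :
    pairing X L = ∑ j ∈ s, Matrix.trace (X.coeff j * L (-j)) :=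
  Finsupp.sum_of_support_subset _ hs _ (by simp)

lemma pairing_piSingle (X : (Matrix (Fin N) (Fin N) 𝕜)[T;T⁻¹]) (j : ℤ)
    (z : Matrix (Fin N) (Fin N) 𝕜) :
    pairing X (Pi.single (-j) z) = Matrix.trace (X.coeff j * z) := by
  rw [pairing_eq_sum_trace X _ (Finset.subset_insert j _),
    Finset.sum_eq_single_of_mem j (Finset.mem_insert_self _ _), Pi.single_eq_same]
  intro k _ hk
  rw [Pi.single_eq_of_ne (by omega), mul_zero, Matrix.trace_zero]

lemma leftMul_monom (j : ℤ) (x : Matrix (Fin N) (Fin N) 𝕜) (L : ℤ → Matrix (Fin N) (Fin N) 𝕜)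
    (i : ℤ) : leftMul (monom j x) L i = x * L (i - j) := by
  rw [leftMul, AddMonoidAlgebra.coeff_single, Finsupp.sum_single_index (by simp)]

lemma rightMul_monom (j : ℤ) (x : Matrix (Fin N) (Fin N) 𝕜) (L : ℤ → Matrix (Fin N) (Fin N) 𝕜)
    (i : ℤ) : rightMul L (monom j x) i = L (i - j) * x := by
  rw [rightMul, AddMonoidAlgebra.coeff_single, Finsupp.sum_single_index (by simp)]

lemma leftMul_add (X Y : (Matrix (Fin N) (Fin N) 𝕜)[T;T⁻¹])
    (L : ℤ → Matrix (Fin N) (Fin N) 𝕜) : leftMul (X + Y) L = leftMul X L + leftMul Y L := by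
  funext i
  rw [leftMul, AddMonoidAlgebra.coeff_add, Finsupp.sum_add_index' (by simp)
    (by simp [Matrix.add_mul])]
  rfl

lemma rightMul_add (X Y : (Matrix (Fin N) (Fin N) 𝕜)[T;T⁻¹])
    (L : ℤ → Matrix (Fin N) (Fin N) 𝕜) : rightMul L (X + Y) = rightMul L X + rightMul L Y := by
  funext i
  rw [rightMul, AddMonoidAlgebra.coeff_add, Finsupp.sum_add_index' (by simp)
    (by simp [Matrix.mul_add])]
  rfl

lemma leftMul_zero (L : ℤ → Matrix (Fin N) (Fin N) 𝕜) : leftMul 0 L = 0 := by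
  funext i; simp [leftMul]

lemma rightMul_zero (L : ℤ → Matrix (Fin N) (Fin N) 𝕜) : rightMul L 0 = 0 := by
  funext i; simp [rightMul]

lemma pairing_mul_left (X Y : (Matrix (Fin N) (Fin N) 𝕜)[T;T⁻¹])
    (L : ℤ → Matrix (Fin N) (Fin N) 𝕜) : pairing (X * Y) L = pairing X (leftMul Y L) := by
  induction X using AddMonoidAlgebra.induction_linear with
  | zero => simp only [zero_mul, pairing_zero_left]
  | add X X' h h' => rw [add_mul, pairing_add_left, pairing_add_left, h, h']
  | single i x =>
    induction Y using AddMonoidAlgebra.induction_linear with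
    | zero => rw [mul_zero, leftMul_zero, pairing_zero_left]; simp [pairing]
    | add Y Y' h h' => rw [mul_add, pairing_add_left, leftMul_add, pairing_add_right, h, h']
    | single j y =>
      rw [AddMonoidAlgebra.single_mul_single, pairing_monom, pairing_monom, leftMul_monom,
        Matrix.mul_assoc, neg_add, sub_eq_add_neg]

lemma pairing_mul_right (X Y : (Matrix (Fin N) (Fin N) 𝕜)[T;T⁻¹])
    (L : ℤ → Matrix (Fin N) (Fin N) 𝕜) : pairing (X * Y) L = pairing Y (rightMul L X) := by
  induction Y using AddMonoidAlgebra.induction_linear with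
  | zero => simp only [mul_zero, pairing_zero_left]
  | add Y Y' h h' => rw [mul_add, pairing_add_left, pairing_add_left, h, h']
  | single j y =>
    induction X using AddMonoidAlgebra.induction_linear with
    | zero => rw [zero_mul, rightMul_zero, pairing_zero_left]; simp [pairing]
    | add X X' h h' => rw [add_mul, pairing_add_left, rightMul_add, pairing_add_right, h, h']
    | single i x =>
      rw [AddMonoidAlgebra.single_mul_single, pairing_monom, pairing_monom, rightMul_monom,
        Matrix.mul_assoc, Matrix.trace_mul_comm, Matrix.mul_assoc, neg_add, neg_add_eq_sub]

/-- Cyclicity of the trace moves everything off `X`. This identifies the coadjoint action and is the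
source of the deformed Lax equation. -/
lemma pairing_bracket (A : Matrix (Fin N) (Fin N) 𝕜) (X M : (Matrix (Fin N) (Fin N) 𝕜)[T;T⁻¹])
    (L : ℤ → Matrix (Fin N) (Fin N) 𝕜) :
    pairing (bracket A X M) L = pairing X (laxRHS A M L) := by
  rw [bracket, laxRHS, pairing_sub_left, mul_assoc, pairing_mul_left, pairing_mul_right,
    pairing_sub_right]

lemma bracket_skew (A : Matrix (Fin N) (Fin N) 𝕜) (X Y : (Matrix (Fin N) (Fin N) 𝕜)[T;T⁻¹]) :
    bracket A X Y = -bracket A Y X := by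
  rw [bracket, bracket, neg_sub]

/-- The bracket is the commutator of the associative product `X A(λ) Y`. -/
lemma bracket_jacobi (A : Matrix (Fin N) (Fin N) 𝕜)
    (X Y Z : (Matrix (Fin N) (Fin N) 𝕜)[T;T⁻¹]) :
    bracket A (bracket A X Y) Z + bracket A (bracket A Y Z) X + bracket A (bracket A Z X) Y = 0 := by
  simp only [bracket, mul_sub, sub_mul, mul_assoc]
  abel

lemma bracket_add_left (A : Matrix (Fin N) (Fin N) 𝕜)
    (X X' Y : (Matrix (Fin N) (Fin N) 𝕜)[T;T⁻¹]) :
    bracket A (X + X') Y = bracket A X Y + bracket A X' Y := by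
  simp only [bracket]; noncomm_ring

lemma bracket_add_right (A : Matrix (Fin N) (Fin N) 𝕜)
    (X Y Y' : (Matrix (Fin N) (Fin N) 𝕜)[T;T⁻¹]) :
    bracket A X (Y + Y') = bracket A X Y + bracket A X Y' := by
  simp only [bracket]; noncomm_ring

lemma bracket_smul_left (A : Matrix (Fin N) (Fin N) 𝕜) (r : 𝕜)
    (X Y : (Matrix (Fin N) (Fin N) 𝕜)[T;T⁻¹]) :
    bracket A (r • X) Y = r • bracket A X Y := by
  simp only [bracket, smul_mul_assoc, mul_smul_comm, smul_sub]

lemma deform_eq (A : Matrix (Fin N) (Fin N) 𝕜) : deform A = 1 - monom 1 A := by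
  rw [deform, ← LaurentPolynomial.single_eq_C_mul_T]

lemma bracket_monom (A : Matrix (Fin N) (Fin N) 𝕜) (i j : ℤ) (x y : Matrix (Fin N) (Fin N) 𝕜) :
    bracket A (monom i x) (monom j y) =
      monom (i + j) (x * y - y * x) + monom (i + j + 1) (-(x * A * y - y * A * x)) := by
  simp only [bracket, deform_eq, mul_sub, sub_mul, mul_one, AddMonoidAlgebra.single_mul_single]
  simp only [sub_eq_add_neg, AddMonoidAlgebra.single_add, AddMonoidAlgebra.single_neg, neg_add,
    neg_neg]
  rw [add_right_comm i 1 j, add_right_comm j 1 i, add_comm j i]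
  abel

end Pairing

/-! ### Closure of the graded spaces under the operations, and nondegeneracy of the pairing. -/

section Graded

variable {𝕜 : Type*} [RCLike 𝕜] {c : Series} {n : ℕ}

lemma monom_mem {j : ℤ} {x : Mat c n 𝕜} (hx : x ∈ grade c n (j : ZMod (c.coxeter n))) :
    monom j x ∈ loopPr 𝕜 c n := by
  intro k
  rw [AddMonoidAlgebra.coeff_single, Finsupp.single_apply]
  split_ifs with h
  · rwa [← h]
  · exact Submodule.zero_mem _

lemma piSingle_mem {j : ℤ} {x : Mat c n 𝕜} (hx : x ∈ grade c n (j : ZMod (c.coxeter n))) :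
    (Pi.single j x : ℤ → Mat c n 𝕜) ∈ dualPr 𝕜 c n := by
  intro k
  by_cases h : k = j
  · subst h; rwa [Pi.single_eq_same]
  · rw [Pi.single_eq_of_ne h]; exact Submodule.zero_mem _

lemma loopPr_induction {p : (Mat c n 𝕜)[T;T⁻¹] → Prop} (zero : p 0)
    (add : ∀ X Y, p X → p Y → p (X + Y))
    (single : ∀ (j : ℤ) (x : Mat c n 𝕜), x ∈ grade c n (j : ZMod (c.coxeter n)) → p (monom j x))
    (X : (Mat c n 𝕜)[T;T⁻¹]) (hX : X ∈ loopPr 𝕜 c n) : p X := by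
  rw [← AddMonoidAlgebra.sum_coeff_single X]
  exact Finset.sum_induction _ p add zero fun j _ => single j _ (hX j)

/-- Test series may only have coefficients in the graded pieces, so an arbitrary test matrix is
projected first, and self-adjointness moves the projection onto `X` and `Y`, which it fixes. -/
lemma eq_of_pairing_left {X Y : loopPr 𝕜 c n}
    (h : ∀ Z : dualPr 𝕜 c n, coordFn X Z = coordFn Y Z) : X = Y := by
  refine Subtype.ext (LaurentPolynomial.ext fun j => Matrix.ext_iff_trace_mul_right.2 fun E => ?_)
  have := h ⟨Pi.single (-j) (gradeProj c n ((-j : ℤ) : ZMod (c.coxeter n)) E),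
    piSingle_mem (gradeProj_mem _ _ _ _)⟩
  simp only [coordFn, pairing_piSingle] at this
  rwa [Int.cast_neg, ← trace_gradeProj_mul, ← trace_gradeProj_mul, gradeProj_eq_self (X.2 j),
    gradeProj_eq_self (Y.2 j)] at this

/-- The element of the loop algebra which represents the functional
`L ↦ Tr (E L_i)` on the dual space. -/
def coeffFunctional (i : ℤ) (E : Mat c n 𝕜) : loopPr 𝕜 c n :=
  ⟨monom (-i) (gradeProj c n ((-i : ℤ) : ZMod (c.coxeter n)) E), monom_mem (gradeProj_mem _ _ _ _)⟩

lemma coordFn_coeffFunctional (i : ℤ) (E : Mat c n 𝕜) (L : dualPr 𝕜 c n) :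
    coordFn (coeffFunctional i E) L = Matrix.trace (E * L.1 i) := by
  rw [coordFn, coeffFunctional, pairing_monom, neg_neg, trace_gradeProj_mul, ← Int.cast_neg,
    neg_neg, gradeProj_eq_self (L.2 i)]

lemma coordFn_coeffFunctional_single (i : ℤ) (p q : Fin (c.size n)) (L : dualPr 𝕜 c n) :
    coordFn (coeffFunctional i (Matrix.single q p 1)) L = L.1 i p q := by
  rw [coordFn_coeffFunctional, Matrix.trace_single_mul, one_smul]

lemma eq_of_pairing_right {V W : dualPr 𝕜 c n}
    (h : ∀ X : loopPr 𝕜 c n, coordFn X V = coordFn X W) : V = W := by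
  refine Subtype.ext (funext fun i => Matrix.ext_iff_trace_mul_left.2 fun E => ?_)
  rw [← coordFn_coeffFunctional, ← coordFn_coeffFunctional, h]

variable {A : Mat c n 𝕜}

lemma commutator_mem {i j k : ℤ} (hk : i + j = k) {x y : Mat c n 𝕜}
    (hx : x ∈ grade c n (i : ZMod (c.coxeter n))) (hy : y ∈ grade c n (j : ZMod (c.coxeter n))) :
    x * y - y * x ∈ grade c n (k : ZMod (c.coxeter n)) := by
  have := gradeProj_mem c n (j + i : ZMod (c.coxeter n)) (x * y - y * x)
  rwa [gradeProj_commutator hy, gradeProj_eq_self hx, ← Int.cast_add, add_comm j, hk] at this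

lemma bracket_coeff_mem (hA : IsDeformation A) {i j k : ℤ} (hk : i + j + 1 = k) {x y : Mat c n 𝕜}
    (hx : x ∈ grade c n (i : ZMod (c.coxeter n))) (hy : y ∈ grade c n (j : ZMod (c.coxeter n))) :
    x * A * y - y * A * x ∈ grade c n (k : ZMod (c.coxeter n)) := by
  have := gradeProj_mem c n (i + j + 1 : ZMod (c.coxeter n)) (x * A * y - y * A * x)
  rw [gradeProj_bracket hA hx, gradeProj_eq_self hy] at this
  rw [← hk]
  exact_mod_cast this

lemma lax_coeff_mem (hA : IsDeformation A) {i j k : ℤ} (hk : i + j + 1 = k) {m l : Mat c n 𝕜}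
    (hl : l ∈ grade c n (i : ZMod (c.coxeter n))) (hm : m ∈ grade c n (j : ZMod (c.coxeter n))) :
    A * m * l - l * m * A ∈ grade c n (k : ZMod (c.coxeter n)) := by
  have := gradeProj_mem c n (i + j + 1 : ZMod (c.coxeter n)) (A * m * l - l * m * A)
  rw [gradeProj_deformed hA hl, gradeProj_eq_self hm] at this
  rw [← hk]
  exact_mod_cast this

lemma bracket_mem (hA : IsDeformation A) {X Y : (Mat c n 𝕜)[T;T⁻¹]} (hX : X ∈ loopPr 𝕜 c n)
    (hY : Y ∈ loopPr 𝕜 c n) : bracket A X Y ∈ loopPr 𝕜 c n := by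
  refine loopPr_induction (p := fun X => bracket A X Y ∈ loopPr 𝕜 c n) (by simp [bracket])
    (fun X X' h h' => ?_) (fun i x hx => ?_) X hX
  · rw [bracket_add_left]; exact Submodule.add_mem _ h h'
  refine loopPr_induction (p := fun Y => bracket A _ Y ∈ loopPr 𝕜 c n) (by simp [bracket])
    (fun X X' h h' => ?_) (fun j y hy => ?_) Y hY
  · rw [bracket_add_right]; exact Submodule.add_mem _ h h'
  rw [bracket_monom]
  exact Submodule.add_mem _ (monom_mem (commutator_mem rfl hx hy))
    (monom_mem (Submodule.neg_mem _ (bracket_coeff_mem hA rfl hx hy)))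

lemma laxRHS_mem (hA : IsDeformation A) {M : (Mat c n 𝕜)[T;T⁻¹]} (hM : M ∈ loopPr 𝕜 c n)
    {L : ℤ → Mat c n 𝕜} (hL : L ∈ dualPr 𝕜 c n) : laxRHS A M L ∈ dualPr 𝕜 c n := by
  refine loopPr_induction (p := fun M => laxRHS A M L ∈ dualPr 𝕜 c n)
    (by simp [laxRHS, leftMul_zero, rightMul_zero]) (fun X X' h h' => ?_) (fun j m hm i => ?_) M hM
  · have : laxRHS A (X + X') L = laxRHS A X L + laxRHS A X' L := by
      simp only [laxRHS, mul_add, add_mul, leftMul_add, rightMul_add]; abel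
    rw [this]; exact Submodule.add_mem _ h h'
  -- The undeformed part involves `L_{i-j}` and the deformed part `L_{i-j-1}`. Since `A` has degree
  -- 1, both land in degree `i`.
  have : laxRHS A (monom j m) L i = (m * L (i - j) - L (i - j) * m) -
      (A * m * L (i - (j + 1)) - L (i - (j + 1)) * m * A) := by
    have h1 : deform A * monom j m = monom j m + monom (j + 1) (-(A * m)) := by
      rw [deform_eq, sub_mul, one_mul, AddMonoidAlgebra.single_mul_single, sub_eq_add_neg,
        ← AddMonoidAlgebra.single_neg, add_comm 1 j]
    have h2 : monom j m * deform A = monom j m + monom (j + 1) (-(m * A)) := by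
      rw [deform_eq, mul_sub, mul_one, AddMonoidAlgebra.single_mul_single, sub_eq_add_neg,
        ← AddMonoidAlgebra.single_neg]
    rw [laxRHS, h1, h2, leftMul_add, rightMul_add]
    simp only [Pi.sub_apply, Pi.add_apply, leftMul_monom, rightMul_monom,
      Matrix.neg_mul, Matrix.mul_neg, Matrix.mul_assoc]
    abel
  rw [this]
  exact Submodule.sub_mem _ (commutator_mem (by ring) hm (hL _))
    (lax_coeff_mem hA (by ring) (hL _) hm)

end Graded

/-! ### Gradients of polynomial functions. -/

section Gradient

variable {𝕜 : Type*} [RCLike 𝕜] {c : Series} {n : ℕ} {F G : dualPr 𝕜 c n → 𝕜}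
  {L : dualPr 𝕜 c n} {M M' : loopPr 𝕜 c n}

lemma coordFn_add (X : loopPr 𝕜 c n) (L L' : dualPr 𝕜 c n) :
    coordFn X (L + L') = coordFn X L + coordFn X L' := pairing_add_right _ _ _

lemma coordFn_smul (X : loopPr 𝕜 c n) (r : 𝕜) (L : dualPr 𝕜 c n) :
    coordFn X (r • L) = r * coordFn X L := pairing_smul_right _ _ _

lemma IsGradient.eq (h : IsGradient F L M) (h' : IsGradient F L M') : M = M' :=
  eq_of_pairing_left fun Z => (h Z).unique (h' Z)

lemma IsGradient.grad_eq (h : IsGradient F L M) : grad F L = M := by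
  have hex : ∃ M, IsGradient F L M := ⟨M, h⟩
  rw [grad, dif_pos hex]
  exact hex.choose_spec.eq h

lemma isGradient_coordFn (X : loopPr 𝕜 c n) (L : dualPr 𝕜 c n) : IsGradient (coordFn X) L X := by
  intro Z
  simp only [coordFn_add, coordFn_smul]
  simpa using ((hasDerivAt_id (0 : 𝕜)).mul_const (coordFn X Z)).const_add (coordFn X L)

lemma isGradient_const (r : 𝕜) (L : dualPr 𝕜 c n) :
    IsGradient (algebraMap 𝕜 (dualPr 𝕜 c n → 𝕜) r) L 0 := by
  intro Z
  have : coordFn (0 : loopPr 𝕜 c n) Z = 0 := pairing_zero_left _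
  rw [this]
  exact hasDerivAt_const _ _

lemma IsGradient.add (h : IsGradient F L M) (h' : IsGradient G L M') :
    IsGradient (F + G) L (M + M') := by
  intro Z
  have : coordFn (M + M') Z = coordFn M Z + coordFn M' Z := pairing_add_left _ _ _
  rw [this]
  exact (h Z).add (h' Z)

lemma IsGradient.mul (h : IsGradient F L M) (h' : IsGradient G L M') :
    IsGradient (F * G) L (F L • M' + G L • M) := by
  intro Z
  have : coordFn (F L • M' + G L • M) Z = coordFn M Z * G L + F L * coordFn M' Z := by
    have h1 : coordFn (F L • M' + G L • M) Z = coordFn (F L • M') Z + coordFn (G L • M) Z :=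
      pairing_add_left _ _ _
    have h2 : coordFn (F L • M') Z = F L * coordFn M' Z := pairing_smul_left _ _ _
    have h3 : coordFn (G L • M) Z = G L * coordFn M Z := pairing_smul_left _ _ _
    rw [h1, h2, h3]
    ring
  rw [this]
  have := (h Z).mul (h' Z)
  simp only [zero_smul, add_zero] at this
  exact this

lemma isGradient_grad (hF : F ∈ polyFn 𝕜 c n) (L : dualPr 𝕜 c n) :
    IsGradient F L (grad F L) := by
  suffices ∃ M, IsGradient F L M by
    obtain ⟨M, hM⟩ := this
    rwa [hM.grad_eq]
  induction hF using Algebra.adjoin_induction with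
  | mem F hF =>
    obtain ⟨X, rfl⟩ := hF
    exact ⟨X, isGradient_coordFn X L⟩
  | algebraMap r => exact ⟨0, isGradient_const r L⟩
  | add F G _ _ hF hG =>
    obtain ⟨M, hM⟩ := hF
    obtain ⟨M', hM'⟩ := hG
    exact ⟨_, hM.add hM'⟩
  | mul F G _ _ hF hG =>
    obtain ⟨M, hM⟩ := hF
    obtain ⟨M', hM'⟩ := hG
    exact ⟨_, hM.mul hM'⟩

lemma isGradient_iff (hF : F ∈ polyFn 𝕜 c n) : IsGradient F L M ↔ M = grad F L :=
  ⟨fun h => h.grad_eq.symm, fun h => h ▸ isGradient_grad hF L⟩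

lemma grad_coordFn (X : loopPr 𝕜 c n) (L : dualPr 𝕜 c n) : grad (coordFn X) L = X :=
  (isGradient_coordFn X L).grad_eq

end Gradient

/-! ### The Lie-Poisson bracket on polynomial functions and the Jacobi identity. -/

section Poisson

variable {𝕜 : Type*} [RCLike 𝕜] {c : Series} {n : ℕ} {A : Mat c n 𝕜}
  {F F' G : dualPr 𝕜 c n → 𝕜}

lemma poisson_skew (A : Mat c n 𝕜) (F G : dualPr 𝕜 c n → 𝕜) :
    poisson A F G = -poisson A G F := by
  funext L
  rw [Pi.neg_apply, poisson, poisson, bracket_skew, pairing_neg_left]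

lemma poisson_add_left (hF : F ∈ polyFn 𝕜 c n) (hF' : F' ∈ polyFn 𝕜 c n) :
    poisson A (F + F') G = poisson A F G + poisson A F' G := by
  funext L
  rw [Pi.add_apply, poisson, ((isGradient_grad hF L).add (isGradient_grad hF' L)).grad_eq]
  change pairing (bracket A ((grad F L).1 + (grad F' L).1) _) _ = _
  rw [bracket_add_left, pairing_add_left]
  rfl

lemma poisson_const_left (r : 𝕜) : poisson A (algebraMap 𝕜 (dualPr 𝕜 c n → 𝕜) r) G = 0 := by
  funext L
  rw [poisson, (isGradient_const r L).grad_eq]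
  change pairing (bracket A 0 _) _ = 0
  simp [bracket, pairing_zero_left]

lemma poisson_mul_left (hF : F ∈ polyFn 𝕜 c n) (hF' : F' ∈ polyFn 𝕜 c n) :
    poisson A (F * F') G = F * poisson A F' G + F' * poisson A F G := by
  funext L
  rw [Pi.add_apply, Pi.mul_apply, Pi.mul_apply, poisson,
    ((isGradient_grad hF L).mul (isGradient_grad hF' L)).grad_eq]
  change pairing (bracket A (F L • (grad F' L).1 + F' L • (grad F L).1) _) _ = _
  rw [bracket_add_left, pairing_add_left, bracket_smul_left, bracket_smul_left, pairing_smul_left,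
    pairing_smul_left]
  rfl

lemma coordFn_mem (X : loopPr 𝕜 c n) : coordFn X ∈ polyFn 𝕜 c n :=
  Algebra.subset_adjoin ⟨X, rfl⟩

/-- The bracket of two elements of the quasigraded Lie algebra. -/
def loopBracket (hA : IsDeformation A) (X Y : loopPr 𝕜 c n) : loopPr 𝕜 c n :=
  ⟨bracket A X.1 Y.1, bracket_mem hA X.2 Y.2⟩

lemma poisson_coordFn (hA : IsDeformation A) (X Y : loopPr 𝕜 c n) :
    poisson A (coordFn X) (coordFn Y) = coordFn (loopBracket hA X Y) := by
  funext L
  rw [poisson, grad_coordFn, grad_coordFn]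
  rfl

/-- `{·, G}` obeys the Leibniz rule on polynomials, so the generators suffice. Skew-symmetry then
allows the same reduction in the second argument. -/
lemma poisson_mem_of_coordFn (hG : ∀ X, poisson A (coordFn X) G ∈ polyFn 𝕜 c n)
    (hF : F ∈ polyFn 𝕜 c n) : poisson A F G ∈ polyFn 𝕜 c n := by
  induction hF using Algebra.adjoin_induction with
  | mem F hF =>
    obtain ⟨X, rfl⟩ := hF
    exact hG X
  | algebraMap r => rw [poisson_const_left]; exact Subalgebra.zero_mem _
  | add F F' hF hF' h h' => rw [poisson_add_left hF hF']; exact Subalgebra.add_mem _ h h'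
  | mul F F' hF hF' h h' =>
    rw [poisson_mul_left hF hF']
    exact Subalgebra.add_mem _ (Subalgebra.mul_mem _ hF h') (Subalgebra.mul_mem _ hF' h)

lemma poisson_mem (hA : IsDeformation A) (hF : F ∈ polyFn 𝕜 c n) (hG : G ∈ polyFn 𝕜 c n) :
    poisson A F G ∈ polyFn 𝕜 c n := by
  refine poisson_mem_of_coordFn (fun X => ?_) hF
  rw [poisson_skew]
  refine Subalgebra.neg_mem _ (poisson_mem_of_coordFn (fun Y => ?_) hG)
  rw [poisson_coordFn hA]
  exact coordFn_mem _

/-- The derivation `{·, G}` of the algebra of polynomial functions. -/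
def hamDer (hA : IsDeformation A) (G : polyFn 𝕜 c n) :
    Derivation 𝕜 (polyFn 𝕜 c n) (polyFn 𝕜 c n) :=
  Derivation.mk'
    { toFun := fun F => ⟨poisson A F.1 G.1, poisson_mem hA F.2 G.2⟩
      map_add' := fun F F' => Subtype.ext (poisson_add_left F.2 F'.2)
      map_smul' := fun r F => Subtype.ext (by
        have h := poisson_mul_left (A := A) (G := G.1) (Subalgebra.algebraMap_mem _ r) F.2
        rw [poisson_const_left, mul_zero, add_zero, ← Algebra.smul_def, ← Algebra.smul_def] at h
        exact h) }
    (fun F F' => Subtype.ext (poisson_mul_left F.2 F'.2))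

/-- The coordinate functions, as elements of the algebra of polynomial functions. -/
def polyCoord (X : loopPr 𝕜 c n) : polyFn 𝕜 c n := ⟨coordFn X, coordFn_mem X⟩

lemma derivation_ext {D D' : Derivation 𝕜 (polyFn 𝕜 c n) (polyFn 𝕜 c n)}
    (h : ∀ X, D (polyCoord X) = D' (polyCoord X)) : D = D' := by
  refine Derivation.ext_of_adjoin_eq_top _ (Algebra.adjoin_adjoin_coe_preimage
    (s := Set.range (coordFn (𝕜 := 𝕜) (c := c) (n := n)))) ?_
  rintro ⟨_, _⟩ ⟨X, rfl⟩
  exact h X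

lemma hamDer_skew (hA : IsDeformation A) (F G : polyFn 𝕜 c n) :
    hamDer hA G F = -hamDer hA F G := Subtype.ext (poisson_skew A F.1 G.1)

/-- The Jacobi identity for the Lie-Poisson bracket. -/
lemma hamDer_jacobi (hA : IsDeformation A) (G H : polyFn 𝕜 c n) :
    ⁅hamDer hA H, hamDer hA G⁆ = hamDer hA (hamDer hA H G) := by
  -- `J` is the cyclic sum `{{F,G},H} + {{G,H},F} + {{H,F},G}`. For fixed `G`, `H` it is a
  -- difference of two derivations applied to `F`, so vanishing on coordinates suffices. Cyclic
  -- symmetry then frees the three arguments one at a time, starting from the Jacobi identity of the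
  -- loop algebra.
  set J : polyFn 𝕜 c n → polyFn 𝕜 c n → polyFn 𝕜 c n → polyFn 𝕜 c n := fun F G H =>
    hamDer hA H (hamDer hA G F) + hamDer hA F (hamDer hA H G) + hamDer hA G (hamDer hA F H) with hJ
  have cyc : ∀ F G H, J F G H = J G H F := fun F G H => by simp only [hJ]; abel
  have key : ∀ F G H, ⁅hamDer hA H, hamDer hA G⁆ F - hamDer hA (hamDer hA H G) F = J F G H := by
    intro F G H
    simp only [hJ, Derivation.commutator_apply]
    rw [hamDer_skew hA F (hamDer hA H G), hamDer_skew hA H F, map_neg]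
    abel
  have ext' : ∀ G H, (∀ X, J (polyCoord X) G H = 0) →
      ⁅hamDer hA H, hamDer hA G⁆ = hamDer hA (hamDer hA H G) := fun G H h =>
    derivation_ext fun X => by rw [← sub_eq_zero, key, h]
  have ext : ∀ G H, (∀ X, J (polyCoord X) G H = 0) → ∀ F, J F G H = 0 := fun G H h F => by
    rw [← key, ext' G H h, sub_self]
  have h0 : ∀ X Y Z, J (polyCoord X) (polyCoord Y) (polyCoord Z) = 0 := by
    intro X Y Z
    have e : ∀ X Y, hamDer hA (polyCoord Y) (polyCoord X) = polyCoord (loopBracket hA X Y) :=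
      fun X Y => Subtype.ext (poisson_coordFn hA X Y)
    simp only [hJ, e]
    refine Subtype.ext (funext fun L => ?_)
    change pairing (bracket A (bracket A X.1 Y.1) Z.1) L.1 +
      pairing (bracket A (bracket A Y.1 Z.1) X.1) L.1 +
      pairing (bracket A (bracket A Z.1 X.1) Y.1) L.1 = 0
    rw [← pairing_add_left, ← pairing_add_left, bracket_jacobi, pairing_zero_left]
  have h1 : ∀ F Y Z, J F (polyCoord Y) (polyCoord Z) = 0 := fun F Y Z => ext _ _ (h0 · Y Z) F
  have h2 : ∀ F G Z, J F G (polyCoord Z) = 0 := fun F G Z =>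
    ext _ _ (fun X => by rw [cyc]; exact h1 G Z X) F
  exact ext' G H fun X => by rw [cyc]; exact h2 G H X

lemma hamDer_comm (hA : IsDeformation A) {G H : polyFn 𝕜 c n} (h : poisson A G.1 H.1 = 0)
    (F : polyFn 𝕜 c n) :
    hamDer hA H (hamDer hA G F) = hamDer hA G (hamDer hA H F) := by
  have h0 : hamDer hA H G = 0 := Subtype.ext h
  have h1 := DFunLike.congr_fun (hamDer_jacobi hA G H) F
  rwa [h0, hamDer_skew, map_zero, neg_zero, Derivation.commutator_apply, sub_eq_zero] at h1

end Poisson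

/-! ### Joint formal flows of commuting derivations. -/

section FormalFlow

lemma finsupp_induction_single {T : Type*} {p : (T →₀ ℕ) → Prop} (zero : p 0)
    (add : ∀ α τ, p α → p (α + Finsupp.single τ 1)) (α : T →₀ ℕ) : p α := by
  induction α using Finsupp.induction with
  | zero => exact zero
  | single_add τ k α _ _ h =>
    clear * - h add
    induction k with
    | zero => simpa using h
    | succ k ih =>
      rw [Finsupp.single_add, add_right_comm]
      exact add _ _ ih

variable {𝕜 R T : Type*} [Field 𝕜] [CommRing R] [Algebra 𝕜 R]

-- `P α` is the monomial `D^α`. It is formed in the submonoid generated by the operators, which is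
-- commutative although the endomorphism ring need not be.
open scoped IsMulCommutative in
lemma exists_monomial_operators {D : T → Module.End 𝕜 R} (hD : ∀ s t, D s * D t = D t * D s) :
    ∃ P : (T →₀ ℕ) → Module.End 𝕜 R, P 0 = 1 ∧
      ∀ α τ, P (α + Finsupp.single τ 1) = P α * D τ := by
  have : IsMulCommutative (Submonoid.closure (Set.range D)) :=
    Submonoid.isMulCommutative_closure _ (by
      rintro _ ⟨s, rfl⟩ _ ⟨t, rfl⟩
      exact hD s t)
  let d : T → Submonoid.closure (Set.range D) := fun τ =>
    ⟨D τ, Submonoid.subset_closure ⟨τ, rfl⟩⟩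
  refine ⟨fun α => (α.prod fun τ k => d τ ^ k : Submonoid.closure (Set.range D)), ?_,
    fun α τ => ?_⟩
  · beta_reduce
    rw [Finsupp.prod_zero_index]
    rfl
  · classical
    beta_reduce
    rw [Finsupp.prod_add_index' (by simp) (fun _ _ _ => pow_add _ _ _),
      Finsupp.prod_single_index (h := fun τ k => d τ ^ k) (pow_zero _), pow_one]
    rfl

/-- The weights are `1 / α!`. -/
lemma exists_factorial_weights [CharZero 𝕜] : ∃ w : (T →₀ ℕ) → 𝕜, w 0 = 1 ∧
    ∀ α τ, w (α + Finsupp.single τ 1) * (α τ + 1) = w α := by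
  classical
  refine ⟨fun α => α.prod fun _ k => ((k.factorial : 𝕜))⁻¹, Finsupp.prod_zero_index, fun α τ => ?_⟩
  beta_reduce
  rw [← Finsupp.mul_prod_erase' α τ _ (by simp),
    ← Finsupp.mul_prod_erase' (α + Finsupp.single τ 1) τ _ (by simp)]
  have h1 : (α + Finsupp.single τ 1).erase τ = α.erase τ := by
    rw [Finsupp.erase_add, Finsupp.erase_single, add_zero]
  rw [h1, Finsupp.add_apply, Finsupp.single_eq_same, Nat.factorial_succ]
  have h2 : ((α τ : 𝕜) + 1) ≠ 0 := Nat.cast_add_one_ne_zero _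
  have h3 : ((α τ).factorial : 𝕜) ≠ 0 := by exact_mod_cast Nat.factorial_ne_zero _
  push_cast
  field_simp

open MvPowerSeries in
/-- The joint formal flow of a family of commuting derivations. -/
theorem existsUnique_formalFlow [CharZero 𝕜] (D : T → Derivation 𝕜 R R)
    (hD : ∀ s t F, D s (D t F) = D t (D s F)) (ev : R →ₐ[𝕜] 𝕜) :
    ∃! Φ : R →ₐ[𝕜] MvPowerSeries T 𝕜, (∀ F, constantCoeff (Φ F) = ev F) ∧
      ∀ τ F, pderiv 𝕜 τ (Φ F) = Φ (D τ F) := by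
  obtain ⟨P, hP0, hP⟩ := exists_monomial_operators (D := fun τ => (D τ : Module.End 𝕜 R))
    (fun s t => LinearMap.ext fun F => hD s t F)
  obtain ⟨w, hw0, hw⟩ := exists_factorial_weights (𝕜 := 𝕜) (T := T)
  have hne : ∀ (α : T →₀ ℕ) τ, ((α τ : 𝕜) + 1) ≠ 0 := fun α τ => Nat.cast_add_one_ne_zero _
  -- The Taylor series: the coefficient of `t^α` is `ev (D^α F) / α!`.
  let φ : R → MvPowerSeries T 𝕜 := fun F α => w α * ev (P α F)
  have hφ : ∀ α F, coeff α (φ F) = w α * ev (P α F) := fun α F => rfl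
  have hφ0 : ∀ F, coeff 0 (φ F) = ev F := fun F => by rw [hφ, hw0, hP0, one_mul]; rfl
  have hφD : ∀ τ F, pderiv 𝕜 τ (φ F) = φ (D τ F) := fun τ F => by
    ext α
    rw [coeff_pderiv, hφ, hφ, hP, ← hw α τ]
    change w _ * ev (P α (D τ F)) * _ = _
    ring
  -- Up to the nonzero factor `α τ + 1`, the coefficient at `α + τ` is the coefficient at `α` of the
  -- derivative in `t_τ`. The Leibniz rules of `D τ` and of the partial derivative reduce it to
  -- products already treated.
  have hmul : ∀ α F G, coeff α (φ (F * G)) = coeff α (φ F * φ G) := by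
    intro α
    induction α using finsupp_induction_single with
    | zero =>
      intro F G
      rw [hφ0, map_mul, ← hφ0, ← hφ0]
      simp only [coeff_zero_eq_constantCoeff, map_mul]
    | add α τ ih =>
      intro F G
      refine mul_right_cancel₀ (hne α τ) ?_
      rw [← coeff_pderiv, ← coeff_pderiv, hφD, Derivation.leibniz, Derivation.leibniz, hφD, hφD]
      have hadd : φ (F • D τ G + G • D τ F) = φ (F * D τ G) + φ (G * D τ F) := by
        ext α
        rw [map_add, hφ, hφ, hφ, map_add, map_add, mul_add]
        rfl
      rw [hadd, map_add, map_add, ih, ih]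
      rfl
  have halg : ∀ r : 𝕜, φ (algebraMap 𝕜 R r) = algebraMap 𝕜 (MvPowerSeries T 𝕜) r := by
    intro r
    refine pderiv.ext (fun τ => ?_) ?_
    · rw [hφD, Derivation.map_algebraMap, Derivation.map_algebraMap]
      ext α
      rw [hφ, map_zero, map_zero, mul_zero, map_zero]
    · rw [← coeff_zero_eq_constantCoeff, hφ0, AlgHom.commutes]
      simp [MvPowerSeries.algebraMap_apply]
  let Φ : R →ₐ[𝕜] MvPowerSeries T 𝕜 :=
    { toFun := φ
      map_one' := by rw [← map_one (algebraMap 𝕜 R), halg, map_one]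
      map_mul' := fun F G => by ext α; exact hmul α F G
      map_zero' := by rw [← map_zero (algebraMap 𝕜 R), halg, map_zero]
      map_add' := fun F G => by
        ext α
        rw [map_add, hφ, hφ, hφ, map_add, map_add, mul_add]
      commutes' := halg }
  refine ⟨Φ, ⟨fun F => hφ0 F, hφD⟩, fun Ψ hΨ => ?_⟩
  have huniq : ∀ α F, coeff α (Ψ F) = coeff α (φ F) := by
    intro α
    induction α using finsupp_induction_single with
    | zero => intro F; rw [hφ0, coeff_zero_eq_constantCoeff]; exact hΨ.1 F
    | add α τ ih =>
      intro F
      refine mul_right_cancel₀ (hne α τ) ?_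
      rw [← coeff_pderiv, ← coeff_pderiv, hφD, hΨ.2, ih]
  exact AlgHom.ext fun F => by ext α; exact huniq α F

end FormalFlow

/-! ### Differentiation of polynomial functions along solution curves. -/

section Solutions

variable {𝕜 : Type*} [RCLike 𝕜] {𝕋 : Type*} [RCLike 𝕋] [NormedAlgebra 𝕋 𝕜] {c : Series} {n : ℕ}
  {A : Mat c n 𝕜} {H : dualPr 𝕜 c n → 𝕜} {U : Set 𝕋} {L : 𝕋 → dualPr 𝕜 c n}

/-- The chain rule, obtained algebraically from the generators and the Leibniz rule; no topology on
the dual space is involved. -/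
lemma IsSolution.hasDerivAt (hL : IsSolution A H U L) {t : 𝕋} (ht : t ∈ U)
    {F : dualPr 𝕜 c n → 𝕜} (hF : F ∈ polyFn 𝕜 c n) :
    HasDerivAt (fun r => F (L r)) (poisson A F H (L t)) t := by
  induction hF using Algebra.adjoin_induction with
  | mem F hF =>
    obtain ⟨X, rfl⟩ := hF
    exact hL t ht X
  | algebraMap r => rw [poisson_const_left]; exact hasDerivAt_const _ _
  | add F F' hF hF' h h' => rw [poisson_add_left hF hF']; exact h.add h'
  | mul F F' hF hF' h h' =>
    rw [poisson_mul_left hF hF']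
    have := h.mul h'
    rwa [add_comm, mul_comm (poisson A F H (L t))] at this

lemma IsSolution.eq_of_poisson_eq_zero (hL : IsSolution A H U L) (hU : IsOpen U)
    (hU' : IsPreconnected U) {F : dualPr 𝕜 c n → 𝕜} (hF : F ∈ polyFn 𝕜 c n)
    (h0 : poisson A F H = 0) {t t' : 𝕋} (ht : t ∈ U) (ht' : t' ∈ U) : F (L t) = F (L t') := by
  have hd : ∀ s ∈ U, HasDerivAt (fun r => F (L r)) 0 s := fun s hs => by
    simpa [h0] using hL.hasDerivAt hs hF
  exact hU.is_const_of_deriv_eq_zero hU'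
    (fun s hs => (hd s hs).differentiableAt.differentiableWithinAt)
    (fun s hs => (hd s hs).deriv) ht ht'

/-- Every matrix entry of every coefficient is a coordinate function, and every coordinate function
is a finite linear combination of such entries. -/
lemma isSolution_iff_of_vectorField (V : dualPr 𝕜 c n → dualPr 𝕜 c n)
    (hV : ∀ L X, poisson A (coordFn X) H L = coordFn X (V L)) :
    IsSolution A H U L ↔ ∀ t ∈ U, ∀ (i : ℤ) (p q : Fin (c.size n)),
      HasDerivAt (fun r : 𝕋 => (L r).1 i p q) ((V (L t)).1 i p q) t := by
  refine forall₂_congr fun t _ => ⟨fun h i p q => ?_, fun h X => ?_⟩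
  · have := h (coeffFunctional i (Matrix.single q p 1))
    simpa only [hV, coordFn_coeffFunctional_single] using this
  · rw [hV]
    simp only [coordFn, pairing, Finsupp.sum, Matrix.trace, Matrix.diag, Matrix.mul_apply]
    exact HasDerivAt.fun_sum fun j _ => HasDerivAt.fun_sum fun p _ => HasDerivAt.fun_sum fun q _ =>
      (h (-j) q p).const_mul _

end Solutions

/-! ### Products of Laurent series over a possibly noncommutative ring. -/

section BoundedSeries

variable {S : Type*} [Ring S]

/-- All coefficients of the series below `d` vanish. -/
def BoundedBelow (d : ℤ) (x : HahnSeries ℤ S) : Prop := ∀ j < d, x.coeff j = 0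

lemma exists_boundedBelow (x : HahnSeries ℤ S) : ∃ d, BoundedBelow d x :=
  ⟨x.order, fun _ => HahnSeries.coeff_eq_zero_of_lt_order⟩

variable {d e : ℤ} {x y : HahnSeries ℤ S}

lemma BoundedBelow.mono (hx : BoundedBelow d x) (h : e ≤ d) : BoundedBelow e x :=
  fun j hj => hx j (hj.trans_le h)

lemma BoundedBelow.add (hx : BoundedBelow d x) (hy : BoundedBelow d y) : BoundedBelow d (x + y) :=
  fun j hj => by rw [HahnSeries.coeff_add, hx j hj, hy j hj, add_zero]

lemma BoundedBelow.sub (hx : BoundedBelow d x) (hy : BoundedBelow d y) : BoundedBelow d (x - y) :=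
  fun j hj => by rw [HahnSeries.coeff_sub, hx j hj, hy j hj, sub_zero]

/-- This replaces summation over the supports by a fixed interval, so that the sum can be projected
or differentiated termwise. The upper end `u` is free so that several products can share one
interval. -/
lemma coeff_mul_eq_sum_left (hx : BoundedBelow d x) (hy : BoundedBelow e y) {j u : ℤ}
    (hu : j - e ≤ u) :
    (x * y).coeff j = ∑ i ∈ Finset.Icc d u, x.coeff i * y.coeff (j - i) := by
  rw [HahnSeries.coeff_mul]
  refine Finset.sum_of_injOn Prod.fst ?_ ?_ ?_ ?_
  · rintro ⟨a, b⟩ h ⟨a', b'⟩ h' (rfl : a = a')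
    simp only [Finset.mem_coe, Finset.mem_antidiagonal] at h h'
    exact Prod.ext rfl (by have := h.2.2; have := h'.2.2; simp at *; omega)
  · rintro ⟨a, b⟩ h
    simp only [Finset.mem_coe, Finset.mem_antidiagonal] at h
    obtain ⟨ha, hb, hab⟩ := h
    simp only [Finset.coe_Icc, Set.mem_Icc]
    constructor
    · by_contra hlt
      exact ha (hx a (by omega))
    · by_contra hlt
      exact hb (hy b (by omega))
  · intro i _ hi
    by_contra hne
    refine hi ⟨(i, j - i), ?_, rfl⟩
    simp only [Finset.mem_coe, Finset.mem_antidiagonal]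
    exact ⟨left_ne_zero_of_mul hne, right_ne_zero_of_mul hne, by simp⟩
  · rintro ⟨a, b⟩ h
    simp only [Finset.mem_antidiagonal] at h
    rw [← h.2.2]
    simp

lemma coeff_mul_eq_sum_right (hx : BoundedBelow d x) (hy : BoundedBelow e y) {j u : ℤ}
    (hu : j - d ≤ u) :
    (x * y).coeff j = ∑ i ∈ Finset.Icc e u, x.coeff (j - i) * y.coeff i := by
  rw [HahnSeries.coeff_mul]
  refine Finset.sum_of_injOn Prod.snd ?_ ?_ ?_ ?_
  · rintro ⟨a, b⟩ h ⟨a', b'⟩ h' (rfl : b = b')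
    simp only [Finset.mem_coe, Finset.mem_antidiagonal] at h h'
    exact Prod.ext (by have := h.2.2; have := h'.2.2; simp at *; omega) rfl
  · rintro ⟨a, b⟩ h
    simp only [Finset.mem_coe, Finset.mem_antidiagonal] at h
    obtain ⟨ha, hb, hab⟩ := h
    simp only [Finset.coe_Icc, Set.mem_Icc]
    constructor
    · by_contra hlt
      exact hb (hy b (by omega))
    · by_contra hlt
      exact ha (hx a (by omega))
  · intro i _ hi
    by_contra hne
    refine hi ⟨(j - i, i), ?_, rfl⟩
    simp only [Finset.mem_coe, Finset.mem_antidiagonal]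
    exact ⟨left_ne_zero_of_mul hne, right_ne_zero_of_mul hne, by simp⟩
  · rintro ⟨a, b⟩ h
    simp only [Finset.mem_antidiagonal] at h
    rw [← h.2.2]
    simp

lemma BoundedBelow.mul (hx : BoundedBelow d x) (hy : BoundedBelow e y) :
    BoundedBelow (d + e) (x * y) := fun j hj => by
  rw [coeff_mul_eq_sum_left hx hy le_rfl, Finset.Icc_eq_empty (by omega), Finset.sum_empty]

end BoundedSeries

/-! ### Expansions at zero and at infinity as series with matrix coefficients. -/

section MatrixSeries

variable {𝕜 : Type*} [RCLike 𝕜] {N : ℕ}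

/-- Formal Laurent series with matrix coefficients. -/
abbrev MatSeries (N : ℕ) (𝕜 : Type*) [RCLike 𝕜] := HahnSeries ℤ (Matrix (Fin N) (Fin N) 𝕜)

lemma trace_coeff_mul_comm (x y : MatSeries N 𝕜) (j : ℤ) :
    Matrix.trace ((x * y).coeff j) = Matrix.trace ((y * x).coeff j) := by
  obtain ⟨d, hx⟩ := exists_boundedBelow x
  obtain ⟨e, hy⟩ := exists_boundedBelow y
  rw [coeff_mul_eq_sum_left hx hy le_rfl, coeff_mul_eq_sum_right hy hx le_rfl, Matrix.trace_sum,
    Matrix.trace_sum]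
  exact Finset.sum_congr rfl fun i _ => Matrix.trace_mul_comm _ _

lemma exists_bound_entries (X : Matrix (Fin N) (Fin N) (LaurentSeries 𝕜)) :
    ∃ d : ℤ, ∀ a b, ∀ j < d, (X a b).coeff j = 0 := by
  obtain ⟨d, hd⟩ := (Set.finite_range fun p : Fin N × Fin N => (X p.1 p.2).order).bddBelow
  exact ⟨d, fun a b j hj => HahnSeries.coeff_eq_zero_of_lt_order
    (hj.trans_le (hd ⟨(a, b), rfl⟩))⟩

/-- A matrix of Laurent series, as a Laurent series with matrix coefficients. -/
def toMatSeriesFun (X : Matrix (Fin N) (Fin N) (LaurentSeries 𝕜)) : MatSeries N 𝕜 :=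
  HahnSeries.ofSuppBddBelow (fun j => X.map fun f => f.coeff j) (by
    obtain ⟨d, hd⟩ := exists_bound_entries X
    refine ⟨d, fun j hj => ?_⟩
    by_contra hlt
    exact hj (Matrix.ext fun a b => hd a b j (not_le.1 hlt)))

lemma coeff_toMatSeriesFun (X : Matrix (Fin N) (Fin N) (LaurentSeries 𝕜)) (j : ℤ) (a b : Fin N) :
    (toMatSeriesFun X).coeff j a b = (X a b).coeff j := rfl

/-- Matrices of Laurent series as Laurent series with matrix coefficients. -/
def toMatSeries : Matrix (Fin N) (Fin N) (LaurentSeries 𝕜) →+* MatSeries N 𝕜 where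
  toFun := toMatSeriesFun
  map_zero' := by ext j a b; rfl
  map_add' X Y := by ext j a b; rfl
  map_one' := by
    ext j a b
    rw [coeff_toMatSeriesFun, Matrix.one_apply, HahnSeries.coeff_one]
    by_cases h : a = b <;> by_cases h' : j = 0 <;>
      simp [h, h', HahnSeries.coeff_one, Matrix.one_apply]
  map_mul' X Y := by
    obtain ⟨d, hd⟩ := exists_bound_entries X
    obtain ⟨e, he⟩ := exists_bound_entries Y
    ext j a b
    rw [coeff_toMatSeriesFun, coeff_mul_eq_sum_left (d := d) (e := e)
      (fun j hj => Matrix.ext fun a b => hd a b j hj)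
      (fun j hj => Matrix.ext fun a b => he a b j hj) le_rfl, Matrix.mul_apply,
      HahnSeries.coeff_sum, Matrix.sum_apply]
    simp only [Matrix.mul_apply]
    rw [Finset.sum_comm]
    exact Finset.sum_congr rfl fun k _ =>
      coeff_mul_eq_sum_left (fun j hj => hd a k j hj) (fun j hj => he k b j hj) le_rfl

lemma coeff_toMatSeries (X : Matrix (Fin N) (Fin N) (LaurentSeries 𝕜)) (j : ℤ) (a b : Fin N) :
    (toMatSeries X).coeff j a b = (X a b).coeff j := rfl

lemma coeff_trace (X : Matrix (Fin N) (Fin N) (LaurentSeries 𝕜)) (j : ℤ) :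
    (Matrix.trace X).coeff j = Matrix.trace ((toMatSeries X).coeff j) := by
  rw [Matrix.trace, HahnSeries.coeff_sum]
  rfl

lemma Half.sgn_mul_sgn (ε : Half) : ε.sgn * ε.sgn = 1 := by cases ε <;> rfl

lemma Half.sgn_mul_sgn_mul (ε : Half) (j : ℤ) : ε.sgn * (ε.sgn * j) = j := by
  rw [← mul_assoc, ε.sgn_mul_sgn, one_mul]

/-- The expansion of `L⁺` or `L⁻` in the local parameter. -/
def halfExp (ε : Half) (L : ℤ → Matrix (Fin N) (Fin N) 𝕜) : MatSeries N 𝕜 :=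
  toMatSeries (halfSeries ε L)

lemma coeff_halfExp (ε : Half) (L : ℤ → Matrix (Fin N) (Fin N) 𝕜) (j : ℤ) :
    (halfExp ε L).coeff j = halfPart ε L (ε.sgn * j) := by
  ext a b
  rw [halfExp, coeff_toMatSeries, halfSeries, Matrix.of_apply, PowerSeries.coeff_coe]
  split_ifs with h
  · rw [halfPart, if_neg]
    · rfl
    · cases ε <;> simp only [Half.Mem, Half.sgn] <;> omega
  · rw [PowerSeries.coeff_mk, Int.natAbs_of_nonneg (not_lt.1 h)]

/-- The least power of the local parameter in the part of the loop algebra which annihilates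
`L⁺`, respectively `L⁻`. -/
def Half.shift : Half → ℤ
  | .plus => 0
  | .minus => 1

lemma Half.mem_neg_iff (ε : Half) (i : ℤ) : ε.Mem (-(ε.sgn * i)) ↔ i < ε.shift := by
  cases ε <;> simp only [Half.Mem, Half.sgn, Half.shift] <;> omega

/-- The bound is complementary to `shift`: a series starting at `ε.shift` times `L^ε` starts at
power 1, hence has no coefficient at 0. -/
lemma boundedBelow_halfExp (ε : Half) (L : ℤ → Matrix (Fin N) (Fin N) 𝕜) :
    BoundedBelow (1 - ε.shift) (halfExp ε L) := fun j hj => by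
  rw [coeff_halfExp, halfPart, if_neg]
  cases ε <;> simp only [Half.Mem, Half.sgn, Half.shift] at * <;> omega

/-- The expansion of `A(λ) = 1 - λ A` in the local parameter. -/
def deformExp (ε : Half) (A : Matrix (Fin N) (Fin N) 𝕜) : MatSeries N 𝕜 :=
  1 - HahnSeries.single ε.sgn A

lemma toMatSeries_deformSeries (ε : Half) (A : Matrix (Fin N) (Fin N) 𝕜) :
    toMatSeries (deformSeries ε A) = deformExp ε A := by
  rw [deformSeries, deformExp, map_sub, map_one]
  congr 1
  ext j a b
  rw [coeff_toMatSeries, Matrix.smul_apply, Matrix.map_apply, smul_eq_mul, HahnSeries.C_apply,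
    HahnSeries.single_mul_single, one_mul, add_zero, HahnSeries.coeff_single,
    HahnSeries.coeff_single]
  split_ifs <;> rfl

/-- The determinant is the reversed characteristic polynomial evaluated at the local parameter or at
its inverse. Either substitution keeps the constant term 1 apart from all other powers, so the
determinant is nonzero. -/
lemma isUnit_det_deformSeries (ε : Half) (A : Matrix (Fin N) (Fin N) 𝕜) :
    IsUnit (deformSeries ε A).det := by
  let f : Polynomial 𝕜 →+* LaurentSeries 𝕜 :=
    Polynomial.eval₂RingHom HahnSeries.C (HahnSeries.single ε.sgn (1 : 𝕜))
  have h1 : deformSeries ε A =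
      f.mapMatrix (1 - (Polynomial.X : Polynomial 𝕜) • A.map Polynomial.C) := by
    rw [deformSeries, map_sub, map_one f.mapMatrix]
    congr 1
    ext1 a b
    simp [f]
  have h2 : ∀ p : Polynomial 𝕜, (f p).coeff 0 = p.eval 0 := by
    intro p
    induction p using Polynomial.induction_on' with
    | add p q hp hq => rw [map_add, HahnSeries.coeff_add, hp, hq, Polynomial.eval_add]
    | monomial k a =>
      have : f (Polynomial.monomial k a) = HahnSeries.single (k * ε.sgn) a := by
        simp [f, HahnSeries.C_apply]
      rw [this, Polynomial.eval_monomial, HahnSeries.coeff_single]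
      rcases Nat.eq_zero_or_pos k with rfl | hk
      · simp
      · rw [if_neg, zero_pow hk.ne', mul_zero]
        cases ε <;> simp only [Half.sgn] <;> omega
  rw [isUnit_iff_ne_zero, h1, ← RingHom.map_det]
  intro h0
  have := h2 A.charpolyRev
  rw [Matrix.eval_charpolyRev, Matrix.charpolyRev, h0] at this
  simp at this

/-- The expansion of `A(λ)⁻¹` in the local parameter. -/
def deformInv (ε : Half) (A : Matrix (Fin N) (Fin N) 𝕜) : MatSeries N 𝕜 :=
  toMatSeries (deformSeries ε A)⁻¹

lemma deformExp_mul_deformInv (ε : Half) (A : Matrix (Fin N) (Fin N) 𝕜) :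
    deformExp ε A * deformInv ε A = 1 := by
  rw [← toMatSeries_deformSeries, deformInv, ← map_mul,
    Matrix.mul_nonsing_inv _ (isUnit_det_deformSeries ε A), map_one]

lemma deformInv_mul_deformExp (ε : Half) (A : Matrix (Fin N) (Fin N) 𝕜) :
    deformInv ε A * deformExp ε A = 1 := by
  rw [← toMatSeries_deformSeries, deformInv, ← map_mul,
    Matrix.nonsing_inv_mul _ (isUnit_det_deformSeries ε A), map_one]

/-- This bound closes the annihilator of `L^ε` under `x A(λ) y`: the orders add to at least `shift -
shift + shift`. -/
lemma boundedBelow_deformExp (ε : Half) (A : Matrix (Fin N) (Fin N) 𝕜) :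
    BoundedBelow (-ε.shift) (deformExp ε A) := by
  intro j hj
  rw [deformExp, HahnSeries.coeff_sub, HahnSeries.coeff_one, HahnSeries.coeff_single, if_neg,
    if_neg, sub_zero]
  all_goals cases ε <;> simp only [Half.sgn, Half.shift] at * <;> omega

lemma invariant_eq (A : Matrix (Fin N) (Fin N) 𝕜) (ε : Half) (m : ℕ+) (k : ℤ)
    (L : ℤ → Matrix (Fin N) (Fin N) 𝕜) :
    invariant A ε m k L = (1 / (m : 𝕜)) *
      Matrix.trace (((halfExp ε L * deformInv ε A) ^ (m : ℕ)).coeff (ε.sgn * k)) := by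
  rw [invariant, coeff_trace, map_pow, map_mul]
  rfl

/-- The expansion of a Laurent polynomial in the local parameter. -/
def loopExp (ε : Half) : (Matrix (Fin N) (Fin N) 𝕜)[T;T⁻¹] →+* MatSeries N 𝕜 :=
  AddMonoidAlgebra.liftNCRingHom HahnSeries.C
    { toFun := fun j => HahnSeries.single (ε.sgn * j.toAdd) 1
      map_one' := by simp
      map_mul' := fun i j => by
        rw [HahnSeries.single_mul_single, toAdd_mul, mul_add, one_mul] }
    (fun x j => by
      change HahnSeries.C x * HahnSeries.single _ 1 = HahnSeries.single _ 1 * HahnSeries.C x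
      rw [HahnSeries.C_apply, HahnSeries.single_mul_single, HahnSeries.single_mul_single, zero_add,
        add_zero, one_mul, mul_one])

lemma loopExp_monom (ε : Half) (j : ℤ) (x : Matrix (Fin N) (Fin N) 𝕜) :
    loopExp ε (monom j x) = HahnSeries.single (ε.sgn * j) x := by
  rw [loopExp, AddMonoidAlgebra.liftNCRingHom_single]
  change HahnSeries.C x * HahnSeries.single (ε.sgn * j) 1 = _
  rw [HahnSeries.C_apply, HahnSeries.single_mul_single, zero_add, mul_one]

lemma coeff_loopExp (ε : Half) (X : (Matrix (Fin N) (Fin N) 𝕜)[T;T⁻¹]) (j : ℤ) :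
    (loopExp ε X).coeff j = X.coeff (ε.sgn * j) := by
  induction X using AddMonoidAlgebra.induction_linear with
  | zero => simp
  | add X Y hX hY =>
    rw [map_add, HahnSeries.coeff_add, hX, hY, AddMonoidAlgebra.coeff_add, Finsupp.add_apply]
  | single i x =>
    rw [loopExp_monom, AddMonoidAlgebra.coeff_single]
    by_cases h : j = ε.sgn * i
    · rw [h, ε.sgn_mul_sgn_mul, Finsupp.single_eq_same, HahnSeries.coeff_single_same]
    · rw [HahnSeries.coeff_single_of_ne h, Finsupp.single_eq_of_ne]
      rintro rfl
      exact h (ε.sgn_mul_sgn_mul j).symm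

lemma loopExp_deform (ε : Half) (A : Matrix (Fin N) (Fin N) 𝕜) :
    loopExp ε (deform A) = deformExp ε A := by
  rw [deform_eq, map_sub, map_one, loopExp_monom, mul_one, deformExp]

lemma pairing_halfPart (ε : Half) (X : (Matrix (Fin N) (Fin N) 𝕜)[T;T⁻¹])
    (L : ℤ → Matrix (Fin N) (Fin N) 𝕜) :
    pairing X (halfPart ε L) = Matrix.trace ((loopExp ε X * halfExp ε L).coeff 0) := by
  induction X using AddMonoidAlgebra.induction_linear with
  | zero => simp [pairing]
  | add X Y hX hY =>
    rw [pairing_add_left, hX, hY, map_add, add_mul, HahnSeries.coeff_add, Matrix.trace_add]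
  | single i x =>
    rw [pairing_monom, loopExp_monom, HahnSeries.coeff_single_mul, coeff_halfExp, zero_sub,
      mul_neg, ε.sgn_mul_sgn_mul]

lemma halfPart_add_halfPart (L : ℤ → Matrix (Fin N) (Fin N) 𝕜) :
    halfPart .plus L + halfPart .minus L = L := by
  funext i
  by_cases h : 0 < i
  · simp [halfPart, Half.Mem, h, not_le.2 h]
  · simp [halfPart, Half.Mem, h, not_lt.1 h]

end MatrixSeries

/-! ### Stabilizers of the halves and vanishing of the bracket on them. -/

section Invariance

variable {𝕜 : Type*} [RCLike 𝕜] {c : Series} {n : ℕ} {A : Mat c n 𝕜}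

/-- The coefficientwise projection of a series onto the loop algebra. -/
def gradeExp (ε : Half) (x : MatSeries (c.size n) 𝕜) : MatSeries (c.size n) 𝕜 :=
  HahnSeries.ofSuppBddBelow
    (fun j => gradeProj c n ((ε.sgn * j : ℤ) : ZMod (c.coxeter n)) (x.coeff j)) (by
      obtain ⟨d, hd⟩ := exists_boundedBelow x
      refine ⟨d, fun j hj => ?_⟩
      by_contra hlt
      exact hj (by simp only [hd j (not_le.1 hlt), map_zero]))

lemma coeff_gradeExp (ε : Half) (x : MatSeries (c.size n) 𝕜) (j : ℤ) :
    (gradeExp ε x).coeff j =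
      gradeProj c n ((ε.sgn * j : ℤ) : ZMod (c.coxeter n)) (x.coeff j) := rfl

lemma BoundedBelow.gradeExp {d : ℤ} {x : MatSeries (c.size n) 𝕜} (hx : BoundedBelow d x)
    (ε : Half) : BoundedBelow d (gradeExp ε x) := fun j hj => by
  rw [coeff_gradeExp, hx j hj, map_zero]

lemma coeff_halfExp_mem (ε : Half) (L : dualPr 𝕜 c n) (j : ℤ) :
    (halfExp ε L.1).coeff j ∈ grade c n ((ε.sgn * j : ℤ) : ZMod (c.coxeter n)) := by
  rw [coeff_halfExp, halfPart]
  split_ifs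
  · exact L.2 _
  · exact Submodule.zero_mem _

lemma coeff_deformed_commutator {N : ℕ} (ε : Half) (A : Matrix (Fin N) (Fin N) 𝕜) {d e j u : ℤ}
    {x l : MatSeries N 𝕜} (hx : BoundedBelow d x) (hl : BoundedBelow e l) (hu : j - d + 1 ≤ u) :
    (deformExp ε A * x * l - l * x * deformExp ε A).coeff j =
      ∑ i ∈ Finset.Icc e u, ((x.coeff (j - i) * l.coeff i - l.coeff i * x.coeff (j - i)) -
        (A * x.coeff (j - ε.sgn - i) * l.coeff i - l.coeff i * x.coeff (j - ε.sgn - i) * A)) := by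
  have hσ : -1 ≤ ε.sgn := by cases ε <;> simp [Half.sgn]
  rw [deformExp, mul_assoc, sub_mul, mul_sub, one_mul, mul_one, HahnSeries.coeff_sub,
    HahnSeries.coeff_sub, HahnSeries.coeff_sub, HahnSeries.coeff_single_mul,
    HahnSeries.coeff_mul_single, coeff_mul_eq_sum_right hx hl (u := u) (by omega),
    coeff_mul_eq_sum_right hx hl (u := u) (by omega),
    coeff_mul_eq_sum_left hl hx (u := u) (by omega),
    coeff_mul_eq_sum_left hl hx (u := u) (by omega), Finset.mul_sum, Finset.sum_mul,
    ← Finset.sum_sub_distrib, ← Finset.sum_sub_distrib, ← Finset.sum_sub_distrib]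
  refine Finset.sum_congr rfl fun i _ => ?_
  rw [mul_assoc A]
  abel

/-- The stabilizing series has arbitrary matrix coefficients, while gradients must lie in the loop
algebra. Each coefficient of the equation is a sum of undeformed and deformed commutators with
coefficients of `L^ε`, and the projection passes through both kinds. -/
lemma deformed_commutator_gradeExp (hA : IsDeformation A) (ε : Half) (L : dualPr 𝕜 c n)
    {x : MatSeries (c.size n) 𝕜}
    (h : deformExp ε A * x * halfExp ε L.1 = halfExp ε L.1 * x * deformExp ε A) :
    deformExp ε A * gradeExp ε x * halfExp ε L.1 =
      halfExp ε L.1 * gradeExp ε x * deformExp ε A := by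
  obtain ⟨d, hx⟩ := exists_boundedBelow x
  have hl := boundedBelow_halfExp ε L.1
  rw [← sub_eq_zero] at h ⊢
  ext1
  funext j
  have h1 := congrArg (fun y => gradeProj c n ((ε.sgn * j : ℤ) : ZMod (c.coxeter n)) (y.coeff j)) h
  simp only [HahnSeries.coeff_zero, map_zero] at h1
  rw [coeff_deformed_commutator ε A hx hl le_rfl, map_sum] at h1
  rw [coeff_deformed_commutator ε A (hx.gradeExp ε) hl le_rfl, HahnSeries.coeff_zero, ← h1]
  refine Finset.sum_congr rfl fun i _ => ?_
  have hi := coeff_halfExp_mem ε L i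
  rw [map_sub, coeff_gradeExp, coeff_gradeExp, ← gradeProj_commutator hi,
    ← gradeProj_deformed hA hi]
  have e1 : ((ε.sgn * i : ℤ) : ZMod (c.coxeter n)) + ((ε.sgn * (j - i) : ℤ) : ZMod (c.coxeter n)) =
      ((ε.sgn * j : ℤ) : ZMod (c.coxeter n)) := by
    rw [← Int.cast_add]; congr 1; ring
  have e2 : ((ε.sgn * i : ℤ) : ZMod (c.coxeter n)) +
      ((ε.sgn * (j - ε.sgn - i) : ℤ) : ZMod (c.coxeter n)) + 1 =
      ((ε.sgn * j : ℤ) : ZMod (c.coxeter n)) := by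
    rw [← Int.cast_add, ← Int.cast_one, ← Int.cast_add]
    congr 1
    linear_combination -ε.sgn_mul_sgn
  rw [e1, e2]

lemma trace_gradeExp_mul (ε : Half) (Z : dualPr 𝕜 c n) (x : MatSeries (c.size n) 𝕜) :
    Matrix.trace ((gradeExp ε x * halfExp ε Z.1).coeff 0) =
      Matrix.trace ((x * halfExp ε Z.1).coeff 0) := by
  obtain ⟨d, hx⟩ := exists_boundedBelow x
  have hl := boundedBelow_halfExp ε Z.1
  rw [coeff_mul_eq_sum_left hx hl le_rfl, coeff_mul_eq_sum_left (hx.gradeExp ε) hl le_rfl,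
    Matrix.trace_sum, Matrix.trace_sum]
  refine Finset.sum_congr rfl fun i _ => ?_
  have hi := coeff_halfExp_mem ε Z (0 - i)
  rw [coeff_gradeExp, trace_gradeProj_mul, ← Int.cast_neg,
    show -(ε.sgn * i) = ε.sgn * (0 - i) by ring, gradeProj_eq_self hi]

/-- The part of the projection of the series `x` to the loop algebra that pairs with `L⁺`,
respectively `L⁻`. -/
def truncate (ε : Half) (x : MatSeries (c.size n) 𝕜) : loopPr 𝕜 c n := by
  classical
  -- The order of `x` bounds the powers of `λ` on one side and the half-condition on the other;
  -- which side is which depends on `ε`, hence the symmetric interval.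
  exact ⟨AddMonoidAlgebra.ofCoeff (Finsupp.onFinset
    (Finset.Icc (-|(exists_boundedBelow x).choose|) |(exists_boundedBelow x).choose|)
    (fun j => if ε.Mem (-j) then
      gradeProj c n (j : ZMod (c.coxeter n)) (x.coeff (ε.sgn * j)) else 0)
    (fun j hj => by
      have hd := (exists_boundedBelow x).choose_spec
      set d := (exists_boundedBelow x).choose
      rw [ite_ne_right_iff] at hj
      obtain ⟨hj, hne⟩ := hj
      have hge : d ≤ ε.sgn * j := by
        by_contra hlt
        exact hne (by rw [hd _ (not_le.1 hlt), map_zero])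
      rw [Finset.mem_Icc]
      have := neg_abs_le d
      have := abs_nonneg d
      cases ε <;> simp only [Half.sgn, Half.Mem] at * <;> omega)), fun j => by
    change (if _ then _ else _) ∈ _
    split_ifs
    · exact gradeProj_mem _ _ _ _
    · exact Submodule.zero_mem _⟩

open Classical in
lemma coeff_truncate (ε : Half) (x : MatSeries (c.size n) 𝕜) (j : ℤ) :
    (truncate ε x).1.coeff j = if ε.Mem (-j) then
      gradeProj c n (j : ZMod (c.coxeter n)) (x.coeff (ε.sgn * j)) else 0 := rfl

lemma boundedBelow_gradeExp_sub_truncate (ε : Half) (x : MatSeries (c.size n) 𝕜) :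
    BoundedBelow ε.shift (gradeExp ε x - loopExp ε (truncate ε x).1) := fun j hj => by
  rw [HahnSeries.coeff_sub, coeff_gradeExp, coeff_loopExp, coeff_truncate,
    if_pos ((ε.mem_neg_iff j).2 hj), ε.sgn_mul_sgn_mul, sub_self]

lemma trace_coeff_zero_mul_halfExp {N : ℕ} {ε : Half} {x : MatSeries N 𝕜}
    (hx : BoundedBelow ε.shift x) (L : ℤ → Matrix (Fin N) (Fin N) 𝕜) :
    Matrix.trace ((x * halfExp ε L).coeff 0) = 0 := by
  rw [(hx.mul (boundedBelow_halfExp ε L)) 0 (by omega), Matrix.trace_zero]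

/-- Neither operation changes the pairing: the projection is self-adjoint, and the discarded powers
annihilate the half. The truncated element in turn sees only that half of `Z`. -/
lemma pairing_truncate (ε : Half) (x : MatSeries (c.size n) 𝕜) (Z : dualPr 𝕜 c n) :
    pairing (truncate ε x).1 Z.1 = Matrix.trace ((x * halfExp ε Z.1).coeff 0) := by
  have h1 : pairing (truncate ε x).1 Z.1 = pairing (truncate ε x).1 (halfPart ε Z.1) := by
    refine Finsupp.sum_congr fun j hj => ?_
    have : ε.Mem (-j) := by
      by_contra h
      rw [Finsupp.mem_support_iff, coeff_truncate, if_neg h] at hj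
      exact hj rfl
    rw [halfPart, if_pos this]
  have h2 := trace_coeff_zero_mul_halfExp (boundedBelow_gradeExp_sub_truncate ε x) Z.1
  rw [sub_mul, HahnSeries.coeff_sub, Matrix.trace_sub, sub_eq_zero, trace_gradeExp_mul] at h2
  rw [h1, pairing_halfPart, h2]

/-- An element of the loop algebra which, up to an element that annihilates the dual space of the
half `ε`, stabilizes `L^ε`. -/
def IsStabilizing (ε : Half) (A : Mat c n 𝕜) (L : dualPr 𝕜 c n) (M : loopPr 𝕜 c n) : Prop :=
  ∃ w o : MatSeries (c.size n) 𝕜, loopExp ε M.1 = w - o ∧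
    deformExp ε A * w * halfExp ε L.1 = halfExp ε L.1 * w * deformExp ε A ∧
    BoundedBelow ε.shift o

/-- The value of the functional `L^ε` on the bracket of two series. -/
def bracketValue {N : ℕ} (ε : Half) (A : Matrix (Fin N) (Fin N) 𝕜)
    (L : ℤ → Matrix (Fin N) (Fin N) 𝕜) (x y : MatSeries N 𝕜) : 𝕜 :=
  Matrix.trace (((x * deformExp ε A * y - y * deformExp ε A * x) * halfExp ε L).coeff 0)

lemma bracketValue_sub_left {N : ℕ} (ε : Half) (A : Matrix (Fin N) (Fin N) 𝕜)
    (L : ℤ → Matrix (Fin N) (Fin N) 𝕜) (x x' y : MatSeries N 𝕜) :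
    bracketValue ε A L (x - x') y = bracketValue ε A L x y - bracketValue ε A L x' y := by
  simp only [bracketValue, ← Matrix.trace_sub, ← HahnSeries.coeff_sub]
  congr 2
  simp only [sub_mul, mul_sub]
  abel

lemma bracketValue_skew {N : ℕ} (ε : Half) (A : Matrix (Fin N) (Fin N) 𝕜)
    (L : ℤ → Matrix (Fin N) (Fin N) 𝕜) (x y : MatSeries N 𝕜) :
    bracketValue ε A L x y = -bracketValue ε A L y x := by
  have : (x * deformExp ε A * y - y * deformExp ε A * x) * halfExp ε L =
      -((y * deformExp ε A * x - x * deformExp ε A * y) * halfExp ε L) := by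
    simp only [sub_mul]; abel
  rw [bracketValue, bracketValue, this, HahnSeries.coeff_neg, Matrix.trace_neg]

/-- By cyclicity the value is the trace of the coefficient at 0 of `y (L^ε w A(λ) - A(λ) w L^ε)`. -/
lemma bracketValue_eq_zero_of_commute {N : ℕ} {ε : Half} {A : Matrix (Fin N) (Fin N) 𝕜}
    {L : ℤ → Matrix (Fin N) (Fin N) 𝕜} {w : MatSeries N 𝕜}
    (h : deformExp ε A * w * halfExp ε L = halfExp ε L * w * deformExp ε A) (y : MatSeries N 𝕜) :
    bracketValue ε A L w y = 0 := by
  rw [bracketValue, sub_mul, HahnSeries.coeff_sub, Matrix.trace_sub, mul_assoc _ y,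
    trace_coeff_mul_comm, ← Matrix.trace_sub, ← HahnSeries.coeff_sub]
  have : y * halfExp ε L * (w * deformExp ε A) - y * deformExp ε A * w * halfExp ε L =
      y * (halfExp ε L * w * deformExp ε A - deformExp ε A * w * halfExp ε L) := by
    simp only [mul_sub, mul_assoc]
  rw [this, h, sub_self, mul_zero, HahnSeries.coeff_zero, Matrix.trace_zero]

lemma bracketValue_eq_zero_of_boundedBelow {N : ℕ} {ε : Half} {A : Matrix (Fin N) (Fin N) 𝕜}
    {L : ℤ → Matrix (Fin N) (Fin N) 𝕜} {x y : MatSeries N 𝕜}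
    (hx : BoundedBelow ε.shift x) (hy : BoundedBelow ε.shift y) :
    bracketValue ε A L x y = 0 := by
  have hD := boundedBelow_deformExp ε A
  refine trace_coeff_zero_mul_halfExp (BoundedBelow.sub ?_ ?_) L
  · exact ((hx.mul hD).mul hy).mono (by omega)
  · exact ((hy.mul hD).mul hx).mono (by omega)

variable {ε : Half} {L : dualPr 𝕜 c n} {M M' : loopPr 𝕜 c n}

lemma IsStabilizing.bracketValue_eq_zero (h : IsStabilizing ε A L M)
    {y : MatSeries (c.size n) 𝕜} (hy : BoundedBelow ε.shift y) :
    bracketValue ε A L.1 (loopExp ε M.1) y = 0 := by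
  obtain ⟨w, o, hM, hw, ho⟩ := h
  rw [hM, bracketValue_sub_left, bracketValue_eq_zero_of_commute hw,
    bracketValue_eq_zero_of_boundedBelow ho hy, sub_zero]

/-- Writing `M = w - o`, the term with `w` vanishes by invariance. In the term with `o` the roles
are exchanged: `M'` is stabilizing and `o` lies in the annihilator. -/
lemma IsStabilizing.bracketValue_eq_zero' (h : IsStabilizing ε A L M)
    (h' : IsStabilizing ε A L M') :
    bracketValue ε A L.1 (loopExp ε M.1) (loopExp ε M'.1) = 0 := by
  obtain ⟨w, o, hM, hw, ho⟩ := h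
  rw [hM, bracketValue_sub_left, bracketValue_eq_zero_of_commute hw, bracketValue_skew,
    h'.bracketValue_eq_zero ho, neg_zero, sub_zero]

lemma pairing_bracket_halfPart (ε : Half) (A : Mat c n 𝕜) (X Y : (Mat c n 𝕜)[T;T⁻¹])
    (L : ℤ → Mat c n 𝕜) : pairing (bracket A X Y) (halfPart ε L) =
      bracketValue ε A L (loopExp ε X) (loopExp ε Y) := by
  rw [pairing_halfPart, bracket, map_sub, map_mul, map_mul, map_mul, map_mul, loopExp_deform]
  rfl

lemma pairing_bracket_halfPart_eq_zero
    (h : IsStabilizing ε A L M ∨ BoundedBelow ε.shift (loopExp ε M.1))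
    (h' : IsStabilizing ε A L M' ∨ BoundedBelow ε.shift (loopExp ε M'.1)) :
    pairing (bracket A M.1 M'.1) (halfPart ε L.1) = 0 := by
  rw [pairing_bracket_halfPart]
  rcases h with h | h <;> rcases h' with h' | h'
  · exact h.bracketValue_eq_zero' h'
  · exact h.bracketValue_eq_zero h'
  · rw [bracketValue_skew, h'.bracketValue_eq_zero h, neg_zero]
  · exact bracketValue_eq_zero_of_boundedBelow h h'

/-- The powers that pair with one half are exactly those that annihilate the other; this handles
Hamiltonians of different sign. -/
lemma boundedBelow_loopExp_truncate {ε ε' : Half} (hε : ε' ≠ ε) (x : MatSeries (c.size n) 𝕜) :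
    BoundedBelow ε'.shift (loopExp ε' (truncate ε x).1) := fun j hj => by
  rw [coeff_loopExp, coeff_truncate, if_neg]
  rw [← ε'.mem_neg_iff] at hj
  cases ε <;> cases ε' <;> simp only [Half.Mem, Half.sgn] at * <;> first | omega | contradiction

lemma isStabilizing_truncate (hA : IsDeformation A) {x : MatSeries (c.size n) 𝕜}
    (h : deformExp ε A * x * halfExp ε L.1 = halfExp ε L.1 * x * deformExp ε A) :
    IsStabilizing ε A L (truncate ε x) :=
  ⟨gradeExp ε x, gradeExp ε x - loopExp ε (truncate ε x).1, by abel,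
    deformed_commutator_gradeExp hA ε L h, boundedBelow_gradeExp_sub_truncate ε x⟩

end Invariance

/-! ### The Hamiltonians are polynomial functions. -/

section PolynomialSeries

variable {𝕜 : Type*} [RCLike 𝕜] {N : ℕ}

lemma coeff_mul_apply {d e : ℤ} {x y : MatSeries N 𝕜} (hx : BoundedBelow d x)
    (hy : BoundedBelow e y) (j : ℤ) (a b : Fin N) : (x * y).coeff j a b =
      ∑ i ∈ Finset.Icc d (j - e), ∑ k, x.coeff i a k * y.coeff (j - i) k b := by
  rw [coeff_mul_eq_sum_left hx hy le_rfl, Matrix.sum_apply]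
  rfl

variable {c : Series} {n : ℕ}

/-- A series which depends on a point of the dual space through polynomial functions. -/
def IsPolySeries (f : dualPr 𝕜 c n → MatSeries N 𝕜) : Prop :=
  ∃ d, (∀ L, BoundedBelow d (f L)) ∧ ∀ j a b, (fun L => (f L).coeff j a b) ∈ polyFn 𝕜 c n

variable {f g : dualPr 𝕜 c n → MatSeries N 𝕜}

lemma isPolySeries_const (x : MatSeries N 𝕜) :
    IsPolySeries (fun _ : dualPr 𝕜 c n => x) := by
  obtain ⟨d, hd⟩ := exists_boundedBelow x
  exact ⟨d, fun _ => hd, fun j a b => Subalgebra.algebraMap_mem _ (x.coeff j a b)⟩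

/-- Since the lower bounds are uniform in `L`, each coefficient of the product is a finite sum over
an index set independent of `L`. -/
lemma IsPolySeries.mul (hf : IsPolySeries f) (hg : IsPolySeries g) :
    IsPolySeries (fun L => f L * g L) := by
  obtain ⟨d, hd, hf⟩ := hf
  obtain ⟨e, he, hg⟩ := hg
  refine ⟨d + e, fun L => (hd L).mul (he L), fun j a b => ?_⟩
  have : (fun L => (f L * g L).coeff j a b) = ∑ i ∈ Finset.Icc d (j - e), ∑ k,
      (fun L => (f L).coeff i a k) * (fun L => (g L).coeff (j - i) k b) := by
    funext L
    simp only [coeff_mul_apply (hd L) (he L), Finset.sum_apply, Pi.mul_apply]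
  rw [this]
  exact Subalgebra.sum_mem _ fun i _ => Subalgebra.sum_mem _ fun k _ =>
    Subalgebra.mul_mem _ (hf _ _ _) (hg _ _ _)

lemma IsPolySeries.pow (hf : IsPolySeries f) (m : ℕ) : IsPolySeries (fun L => f L ^ m) := by
  induction m with
  | zero => simpa only [pow_zero] using isPolySeries_const 1
  | succ m ih => simpa only [pow_succ] using ih.mul hf

lemma isPolySeries_halfExp (ε : Half) :
    IsPolySeries (fun L : dualPr 𝕜 c n => halfExp ε L.1) := by
  refine ⟨_, fun L => boundedBelow_halfExp ε L.1, fun j a b => ?_⟩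
  simp only [coeff_halfExp, halfPart]
  split_ifs
  · simp only [← coordFn_coeffFunctional_single]
    exact coordFn_mem _
  · exact Subalgebra.zero_mem _

lemma ham_mem (A : Mat c n 𝕜) (τ : Time) : ham A τ ∈ polyFn 𝕜 c n := by
  obtain ⟨d, -, h⟩ := ((isPolySeries_halfExp (𝕜 := 𝕜) (c := c) (n := n) τ.1).mul
    (isPolySeries_const (deformInv τ.1 A))).pow (τ.2.1 : ℕ)
  have : ham A τ = (1 / ((τ.2.1 : ℕ) : 𝕜)) • ∑ a, fun L : dualPr 𝕜 c n =>
      ((halfExp τ.1 L.1 * deformInv τ.1 A) ^ (τ.2.1 : ℕ)).coeff (τ.1.sgn * τ.2.2) a a := by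
    funext L
    rw [ham, invariant_eq, Pi.smul_apply, Finset.sum_apply]
    rfl
  rw [this]
  exact Subalgebra.smul_mem _ (Subalgebra.sum_mem _ fun a _ => h _ _ _) _

end PolynomialSeries

/-! ### Gradients of the Hamiltonians and their involution. -/

section Differentiation

variable {𝕜 : Type*} [RCLike 𝕜] {N : ℕ}

/-- The series `f r` has the coefficientwise derivative `x` at `r = 0`. -/
def HasCoeffDeriv (f : 𝕜 → MatSeries N 𝕜) (x : MatSeries N 𝕜) : Prop :=
  ∃ d, (∀ r, BoundedBelow d (f r)) ∧ BoundedBelow d x ∧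
    ∀ j a b, HasDerivAt (fun r => (f r).coeff j a b) (x.coeff j a b) 0

variable {f g : 𝕜 → MatSeries N 𝕜} {x y : MatSeries N 𝕜}

lemma hasCoeffDeriv_const (y : MatSeries N 𝕜) : HasCoeffDeriv (fun _ : 𝕜 => y) 0 := by
  obtain ⟨d, hd⟩ := exists_boundedBelow y
  exact ⟨d, fun _ => hd, fun _ _ => rfl, fun j a b => hasDerivAt_const _ _⟩

lemma HasCoeffDeriv.mul (hf : HasCoeffDeriv f x) (hg : HasCoeffDeriv g y) :
    HasCoeffDeriv (fun r => f r * g r) (x * g 0 + f 0 * y) := by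
  obtain ⟨d, hd, hx, hf⟩ := hf
  obtain ⟨e, he, hy, hg⟩ := hg
  refine ⟨d + e, fun r => (hd r).mul (he r), (hx.mul (he 0)).add ((hd 0).mul hy),
    fun j a b => ?_⟩
  simp only [coeff_mul_apply (hd _) (he _)]
  rw [HahnSeries.coeff_add, Matrix.add_apply, coeff_mul_apply hx (he 0),
    coeff_mul_apply (hd 0) hy, ← Finset.sum_add_distrib]
  simp only [← Finset.sum_add_distrib]
  exact HasDerivAt.fun_sum fun i _ => HasDerivAt.fun_sum fun k _ => (hf i a k).mul (hg (j - i) k b)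

/-- The derivative of a power is a sum of noncommuting products that agree only under the trace. The
factor `f 0 ^ e` strengthens the statement enough for induction on `m`; the truncated `m - 1` is
harmless at `m = 0` because of the factor `m`. -/
lemma HasCoeffDeriv.pow (hf : HasCoeffDeriv f x) (m : ℕ) :
    ∃ y, HasCoeffDeriv (fun r => f r ^ m) y ∧ ∀ e : ℕ, ∀ j,
      Matrix.trace ((y * f 0 ^ e).coeff j) =
        m * Matrix.trace ((x * f 0 ^ (m - 1 + e)).coeff j) := by
  induction m with
  | zero =>
    refine ⟨0, ?_, fun e j => by simp⟩
    simpa only [pow_zero] using hasCoeffDeriv_const (𝕜 := 𝕜) 1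
  | succ m ih =>
    obtain ⟨y, hy, hyt⟩ := ih
    refine ⟨_, by simpa only [pow_succ] using hy.mul hf, fun e j => ?_⟩
    rw [add_mul, HahnSeries.coeff_add, Matrix.trace_add, mul_assoc, ← pow_succ', hyt,
      mul_assoc (f 0 ^ m), trace_coeff_mul_comm (f 0 ^ m), mul_assoc, ← pow_add,
      Nat.add_sub_cancel, add_comm e m]
    rcases Nat.eq_zero_or_pos m with rfl | hm
    · simp
    · rw [show m - 1 + (e + 1) = m + e by omega]
      push_cast
      ring

lemma HasCoeffDeriv.hasDerivAt_trace (hf : HasCoeffDeriv f x) (j : ℤ) :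
    HasDerivAt (fun r => Matrix.trace ((f r).coeff j)) (Matrix.trace (x.coeff j)) 0 := by
  obtain ⟨-, -, -, hf⟩ := hf
  exact HasDerivAt.fun_sum fun a _ => hf j a a

variable {c : Series} {n : ℕ}

lemma hasCoeffDeriv_halfExp (ε : Half) (L Z : ℤ → Matrix (Fin N) (Fin N) 𝕜) :
    HasCoeffDeriv (fun r : 𝕜 => halfExp ε (L + r • Z)) (halfExp ε Z) := by
  refine ⟨_, fun r => boundedBelow_halfExp ε _, boundedBelow_halfExp ε _, fun j a b => ?_⟩
  simp only [coeff_halfExp, halfPart]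
  split_ifs
  · simpa using ((hasDerivAt_id (0 : 𝕜)).mul_const (Z (ε.sgn * j) a b)).const_add
      (L (ε.sgn * j) a b)
  · exact hasDerivAt_const _ _

/-- The series `λ ^ {-k} A⁻¹ (L A⁻¹) ^ {m - 1}`, of which the gradient of `I^m_k` is a part. -/
def gradExp (A : Matrix (Fin N) (Fin N) 𝕜) (τ : Time) (L : ℤ → Matrix (Fin N) (Fin N) 𝕜) :
    MatSeries N 𝕜 :=
  HahnSeries.single (-(τ.1.sgn * τ.2.2)) 1 *
    (deformInv τ.1 A * (halfExp τ.1 L * deformInv τ.1 A) ^ ((τ.2.1 : ℕ) - 1))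

lemma single_one_mul_comm (k : ℤ) (x : MatSeries N 𝕜) :
    HahnSeries.single k 1 * x = x * HahnSeries.single k 1 := by
  ext1
  funext j
  rw [HahnSeries.coeff_single_mul, HahnSeries.coeff_mul_single, one_mul, mul_one]

/-- Powers of `λ` are central, and cancelling `A(λ)⁻¹` on either side leaves `λ^{-k} (L^ε
A(λ)⁻¹)^{m-1} L^ε`. -/
lemma gradExp_commute (A : Matrix (Fin N) (Fin N) 𝕜) (τ : Time)
    (L : ℤ → Matrix (Fin N) (Fin N) 𝕜) :
    deformExp τ.1 A * gradExp A τ L * halfExp τ.1 L =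
      halfExp τ.1 L * gradExp A τ L * deformExp τ.1 A := by
  have h1 := deformExp_mul_deformInv τ.1 A
  have h2 := deformInv_mul_deformExp τ.1 A
  rw [gradExp]
  set l := halfExp τ.1 L
  set D := deformExp τ.1 A
  set E := deformInv τ.1 A
  set s : MatSeries N 𝕜 := HahnSeries.single (-(τ.1.sgn * τ.2.2)) 1
  have e1 : D * (s * (E * (l * E) ^ ((τ.2.1 : ℕ) - 1))) * l =
      s * ((l * E) ^ ((τ.2.1 : ℕ) - 1) * l) := by
    rw [← mul_assoc D, ← single_one_mul_comm, mul_assoc s, ← mul_assoc D, h1, one_mul, mul_assoc]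
  have e2 : l * (s * (E * (l * E) ^ ((τ.2.1 : ℕ) - 1))) * D =
      s * ((l * E) ^ ((τ.2.1 : ℕ) - 1) * l) := by
    rw [← mul_assoc l, ← single_one_mul_comm, mul_assoc s, mul_assoc s, ← mul_assoc l,
      ← pow_succ', pow_succ, mul_assoc _ _ D, mul_assoc l E D, h2, mul_one]
  rw [e1, e2]

/-- The factor `m` from differentiating the trace cancels `1 / m`. Cyclicity brings `Z^ε` to the
right end, and multiplying by `λ^{-k}` moves the coefficient of `λ^k` to 0, where `pairing_truncate`
applies. -/
lemma isGradient_ham (A : Mat c n 𝕜) (τ : Time) (L : dualPr 𝕜 c n) :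
    IsGradient (ham A τ) L (truncate τ.1 (gradExp A τ L.1)) := by
  intro Z
  obtain ⟨ε, m, k⟩ := τ
  have hB := (hasCoeffDeriv_halfExp ε L.1 Z.1).mul (hasCoeffDeriv_const (deformInv ε A))
  obtain ⟨y, hy, hyt⟩ := hB.pow (m : ℕ)
  have hd := (hy.hasDerivAt_trace (ε.sgn * k)).const_mul (1 / (m : 𝕜))
  have hval : coordFn (truncate ε (gradExp A (ε, m, k) L.1)) Z =
      1 / (m : 𝕜) * Matrix.trace (y.coeff (ε.sgn * k)) := by
    have hm : (m : 𝕜) ≠ 0 := by exact_mod_cast m.ne_zero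
    have h0 := hyt 0 (ε.sgn * k)
    rw [pow_zero, mul_one, add_zero] at h0
    rw [coordFn, pairing_truncate, h0, trace_coeff_mul_comm, gradExp, ← mul_assoc,
      ← single_one_mul_comm, mul_assoc, HahnSeries.coeff_single_mul, one_mul]
    simp only [zero_smul, add_zero, mul_zero]
    rw [← mul_assoc (1 / (m : 𝕜)), one_div, inv_mul_cancel₀ hm, one_mul, sub_neg_eq_add, zero_add,
      mul_assoc]
  rw [hval]
  refine hd.congr_of_eventuallyEq (Filter.Eventually.of_forall fun r => ?_)
  exact invariant_eq A ε m k _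

lemma grad_ham (A : Mat c n 𝕜) (τ : Time) (L : dualPr 𝕜 c n) :
    grad (ham A τ) L = truncate τ.1 (gradExp A τ L.1) :=
  (isGradient_ham A τ L).grad_eq

/-- On each half, a gradient either stabilizes that half up to its annihilator or lies in the
annihilator, according to whether its Hamiltonian belongs to the half. Equal and different signs are
thus covered together. -/
lemma poisson_ham_ham {A : Mat c n 𝕜} (hA : IsDeformation A) (τ τ' : Time) :
    poisson A (ham A τ') (ham A τ) = 0 := by
  have key : ∀ (τ : Time) (ε : Half) (L : dualPr 𝕜 c n),
      IsStabilizing ε A L (grad (ham A τ) L) ∨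
        BoundedBelow ε.shift (loopExp ε (grad (ham A τ) L).1) := by
    intro τ ε L
    rw [grad_ham]
    by_cases h : ε = τ.1
    · subst h
      exact Or.inl (isStabilizing_truncate hA (gradExp_commute A τ L.1))
    · exact Or.inr (boundedBelow_loopExp_truncate h _)
  funext L
  rw [poisson, ← halfPart_add_halfPart L.1, pairing_add_right,
    pairing_bracket_halfPart_eq_zero (key τ' _ L) (key τ _ L),
    pairing_bracket_halfPart_eq_zero (key τ' _ L) (key τ _ L), add_zero, Pi.zero_apply]

end Differentiation

/-! ### The commuting flows, their formal trajectories and the Lax vector field. -/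

section Flows

variable {𝕜 : Type*} [RCLike 𝕜] {c : Series} {n : ℕ} {A : Mat c n 𝕜}

/-- The Hamiltonians, as elements of the algebra of polynomial functions. -/
def polyHam (A : Mat c n 𝕜) (τ : Time) : polyFn 𝕜 c n := ⟨ham A τ, ham_mem A τ⟩

lemma hamDer_polyHam_comm (hA : IsDeformation A) (τ τ' : Time) (F : polyFn 𝕜 c n) :
    hamDer hA (polyHam A τ') (hamDer hA (polyHam A τ) F) =
      hamDer hA (polyHam A τ) (hamDer hA (polyHam A τ') F) :=
  hamDer_comm hA (G := polyHam A τ) (H := polyHam A τ') (poisson_ham_ham hA τ' τ) F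

variable (𝕜 c n) in
/-- The evaluation of polynomial functions at a point of the dual space. -/
def evalAt (L : dualPr 𝕜 c n) : polyFn 𝕜 c n →ₐ[𝕜] 𝕜 :=
  (Pi.evalAlgHom 𝕜 (fun _ : dualPr 𝕜 c n => 𝕜) L).comp (polyFn 𝕜 c n).val

lemma isFormalFlow_iff (hA : IsDeformation A) (L : dualPr 𝕜 c n)
    (Φ : polyFn 𝕜 c n →ₐ[𝕜] MvPowerSeries Time 𝕜) :
    IsFormalFlow A L Φ ↔ (∀ F, MvPowerSeries.constantCoeff (Φ F) = evalAt 𝕜 c n L F) ∧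
      ∀ τ F, MvPowerSeries.pderiv 𝕜 τ (Φ F) = Φ (hamDer hA (polyHam A τ) F) := by
  refine and_congr Iff.rfl ⟨fun h τ F => h τ F _ rfl, fun h τ F G hG => ?_⟩
  rw [h τ F]
  exact congrArg Φ (Subtype.ext hG.symm)

lemma existsUnique_isFormalFlow (hA : IsDeformation A) (L : dualPr 𝕜 c n) :
    ∃! Φ : polyFn 𝕜 c n →ₐ[𝕜] MvPowerSeries Time 𝕜, IsFormalFlow A L Φ := by
  simp only [isFormalFlow_iff hA]
  exact existsUnique_formalFlow (fun τ => hamDer hA (polyHam A τ))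
    (fun τ τ' F => hamDer_polyHam_comm hA τ' τ F) (evalAt 𝕜 c n L)

/-- The Hamiltonian vector field, in the deformed Lax form. -/
def laxField (hA : IsDeformation A) (τ : Time) (L : dualPr 𝕜 c n) : dualPr 𝕜 c n :=
  ⟨laxRHS A (grad (ham A τ) L).1 L.1, laxRHS_mem hA (grad (ham A τ) L).2 L.2⟩

lemma poisson_coordFn_ham (hA : IsDeformation A) (τ : Time) (L : dualPr 𝕜 c n)
    (X : loopPr 𝕜 c n) :
    poisson A (coordFn X) (ham A τ) L = coordFn X (laxField hA τ L) := by
  rw [poisson, grad_coordFn, pairing_bracket]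
  rfl

end Flows

end QuasigradedLie
end

open QuasigradedLie

theorem theorem1 {𝕜 : Type*} [RCLike 𝕜] {𝕋 : Type*} [RCLike 𝕋] [NormedAlgebra 𝕋 𝕜]
    (c : Series) (n : ℕ) (hn : c.minRank ≤ n) (a : ℕ → 𝕜) (A : Mat c n 𝕜)
    (hA : A = deformationMatrix c n a) :
    -- the Hamiltonians are polynomials; their gradients exist, are unique, and are Laurent
    -- polynomials with powers `λ ^ j`, `j ≥ 0` (for `L⁻`), respectively `j < 0` (for `L⁺`)
    (∀ τ : Time, ham A τ ∈ polyFn 𝕜 c n ∧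
      ∀ L : dualPr 𝕜 c n,
        (∀ M : loopPr 𝕜 c n, IsGradient (ham A τ) L M ↔ M = grad (ham A τ) L) ∧
        ∀ j : ℤ, ¬ τ.1.Mem (-j) → (grad (ham A τ) L).1.coeff j = 0) ∧
    -- (i) the derivations `{·, H}` of the algebra of polynomial functions are well defined and
    -- commute, and the flows have a unique joint formal trajectory through every point
    (∀ τ : Time, ∀ F ∈ polyFn 𝕜 c n, poisson A F (ham A τ) ∈ polyFn 𝕜 c n) ∧
    (∀ τ τ' : Time, ∀ F ∈ polyFn 𝕜 c n,
      poisson A (poisson A F (ham A τ)) (ham A τ') =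
        poisson A (poisson A F (ham A τ')) (ham A τ)) ∧
    (∀ L₀ : dualPr 𝕜 c n, ∃! Φ : polyFn 𝕜 c n →ₐ[𝕜] MvPowerSeries Time 𝕜,
      IsFormalFlow A L₀ Φ) ∧
    -- (ii) the Hamiltonian vector field exists, is unique, and has the deformed Lax form;
    -- the Hamiltonian equations are the deformed Lax equations
    (∀ (τ : Time) (L : dualPr 𝕜 c n),
      laxRHS A (grad (ham A τ) L).1 L.1 ∈ dualPr 𝕜 c n ∧
      ∀ V : dualPr 𝕜 c n,
        (∀ X : loopPr 𝕜 c n, coordFn X V = poisson A (coordFn X) (ham A τ) L) ↔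
          V.1 = laxRHS A (grad (ham A τ) L).1 L.1) ∧
    (∀ (τ : Time) (U : Set 𝕋) (L : 𝕋 → dualPr 𝕜 c n),
      IsSolution A (ham A τ) U L ↔
        ∀ t ∈ U, ∀ (i : ℤ) (p q : Fin (c.size n)),
          HasDerivAt (fun r : 𝕋 => (L r).1 i p q)
            (laxRHS A (grad (ham A τ) (L t)).1 (L t).1 i p q) t) ∧
    -- (iii) all the Hamiltonians Poisson commute and are constant along all the flows
    (∀ τ τ' : Time, poisson A (ham A τ') (ham A τ) = 0) ∧
    (∀ (τ τ' : Time) (U : Set 𝕋) (L : 𝕋 → dualPr 𝕜 c n), IsOpen U → IsPreconnected U →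
      IsSolution A (ham A τ) U L →
        ∀ t ∈ U, ∀ t' ∈ U, ham A τ' (L t) = ham A τ' (L t')) := by
  have hA' : IsDeformation A := hA ▸ isDeformation_deformationMatrix c n hn a
  refine ⟨fun τ => ⟨ham_mem A τ, fun L => ⟨fun M => isGradient_iff (ham_mem A τ), fun j hj => ?_⟩⟩,
    fun τ F hF => poisson_mem hA' hF (ham_mem A τ),
    fun τ τ' F hF => congrArg Subtype.val (hamDer_polyHam_comm hA' τ τ' ⟨F, hF⟩),
    existsUnique_isFormalFlow hA', fun τ L => ⟨(laxField hA' τ L).2, fun V => ⟨fun h => ?_,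
      fun h X => ?_⟩⟩, fun τ U L => isSolution_iff_of_vectorField (laxField hA' τ)
      (poisson_coordFn_ham hA' τ), poisson_ham_ham hA', fun τ τ' U L hU hU' hL t ht t' ht' =>
      hL.eq_of_poisson_eq_zero hU hU' (ham_mem A τ') (poisson_ham_ham hA' τ τ') ht ht'⟩
  · rw [grad_ham, coeff_truncate, if_neg hj]
  · exact congrArg Subtype.val (eq_of_pairing_right (V := V) (W := laxField hA' τ L)
      fun X => by rw [h, poisson_coordFn_ham hA'])
  · rw [poisson_coordFn_ham hA', show V = laxField hA' τ L from Subtype.ext h]
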